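/- Let $d\ge 2$. For $0<\alpha<d$ put $\gamma(\alpha)=\pi^{d/2}2^{\alpha}\Gamma(\alpha/2)/\Gamma((d-\alpha)/2)$ and $I_\alpha f(x)=\frac1{\gamma(\alpha)}\int_{\mathbb R^d}\frac{f(y)}{|x-y|^{d-\alpha}}\,dy$. Put $\kappa_d=\pi^{d/2}2^{d-1}\Gamma(d/2)$ (so $\kappa_2=2\pi$), let $$I_df(x)=\frac1{\kappa_d}\int_{\mathbb R^d}\log\frac1{|x-y|}\,f(y)\,dy$$ be the logarithmic potential, and let $Rf=\nabla I_1f$ (in the sense of distributions) be the vector-valued Riesz transform. (a) Let $f\in L^1(\mathbb R^d)$ with $\int |f(y)|\log(1+|y|)\,dy<\infty$ and $Rf\in L^1(\mathbb R^d;\mathbb R^d)$. Then the integral defining $I_df(x)$ converges absolutely for almost every $x$, and for every $x$ at which it does, so does the integral defining $I_{d-1}(I_1f)(x)$, and $$I_df(x)=I_{d-1}(I_1f)(x)=\frac{1}{(d-1)\gamma(d-1)}\int_{\mathbb R^d}Rf(y)\cdot\frac{x-y}{|x-y|}\,dy .$$ In particular, if $f\in C_c^\infty(\mathbb R^d)$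 and the pointwise gradient $\nabla I_1f$ is integrable, then $\nabla I_1 f$ is the Riesz transform of $f$ also in the sense of distributions, and these equalities hold for every $x\in\mathbb R^d$. (b) In the plane, for $f$ as in (a), $I_2f(x)=\frac1{2\pi}\int_{\mathbb R^2}\log\frac1{|x-y|}f(y)\,dy=\frac1{2\pi}\int_{\mathbb R^2}\frac{x-y}{|x-y|}\cdot Rf(y)\,dy$ for every $x$ at which the logarithmic integral converges absolutely (in particular for almost every $x$), and $\|I_2f\|_{L^\infty(\mathbb R^2)}\le\frac1{2\pi}\|Rf\|_{L^1(\mathbb R^2;\mathbb R^2)}$. For $g\in L^\infty(\mathbb R^d)$ let $R_jg$ denote the element of $BMO(\mathbb R^d)$ (functions modulo constants) with $\langle R_jg,\varphi\rangle=-\int g\,\partial_jI_1\varphi\,dx$ for all $\varphi\in C_c^\infty(\mathbb R^d)$ with $\int\varphi=0$. (c) The function $\log|x|$ belongs to $BMO(\mathbb R^d)$, the functions $g_j(x)=\frac{1}{(d-1)\gamma(d-1)}\frac{x_j}{|x|}$ belong to $L^\infty(\mathbb R^d)$, each $R_jg_j$ exists in $BMO(\mathbb R^d)$, and, modulo constants,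 $$\log|x|=-\kappa_d\sum_{j=1}^dR_jg_j .$$ (d) Let $\Omega\subset\mathbb R^d$ be bounded and measurable and $f\in L^1(\Omega)$. Then $u(x)=\int_\Omega\log|x-y|\,f(y)\,dy$ belongs to $BMO(\mathbb R^d)$, the functions $g_j(x)=\frac{1}{(d-1)\gamma(d-1)}\int_\Omega\frac{x_j-y_j}{|x-y|}f(y)\,dy$ belong to $L^\infty(\mathbb R^d)$, each $R_jg_j$ exists in $BMO(\mathbb R^d)$, and, modulo constants, $u=-\kappa_d\sum_{j=1}^dR_jg_j$. -/

import Mathlib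

noncomputable section

/-- `ℝ^d` with its Euclidean norm and Lebesgue measure. -/
abbrev Rd (d : ℕ) : Type := EuclideanSpace ℝ (Fin d)

/-- The normalizing constant
`γ(α) = π^{d/2} 2^α Γ(α/2) / Γ((d-α)/2)` of the Riesz potential of order `α` on `ℝ^d`. -/
def rieszGamma (d : ℕ) (α : ℝ) : ℝ :=
  Real.pi ^ ((d : ℝ) / 2) * 2 ^ α * Real.Gamma (α / 2) / Real.Gamma (((d : ℝ) - α) / 2)

/-- The Riesz potential `I_α f(x) = γ(α)⁻¹ ∫ f(y) / |x-y|^{d-α} dy`, for `0 < α < d`. -/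
def rieszPotential (d : ℕ) (α : ℝ) (f : Rd d → ℝ) (x : Rd d) : ℝ :=
  1 / rieszGamma d α * ∫ y, f y / ‖x - y‖ ^ ((d : ℝ) - α)

/-- The constant `κ_d = π^{d/2} 2^{d-1} Γ(d/2)`, equal to `(2π)^d / |S^{d-1}|`. It is the
normalization of the logarithmic kernel: as `α` increases to `d`, the function
`γ(α)⁻¹ (|x|^{α-d} - 1)` converges to `κ_d⁻¹ log (1/|x|)`. In the plane `κ_2 = 2π`. -/
def logGamma (d : ℕ) : ℝ :=
  Real.pi ^ ((d : ℝ) / 2) * 2 ^ ((d : ℝ) - 1) * Real.Gamma ((d : ℝ) / 2)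

/-- The logarithmic potential `I_d f(x) = κ_d⁻¹ ∫ log (1/|x-y|) f(y) dy`, the Riesz potential of
the critical order `d`. -/
def logPotential (d : ℕ) (f : Rd d → ℝ) (x : Rd d) : ℝ :=
  1 / logGamma d * ∫ y, Real.log (1 / ‖x - y‖) * f y

/-- The vector-valued Riesz transform `Rf = ∇ I_1 f`, for functions `f` (such as smooth compactly
supported ones) whose potential `I_1 f` is differentiable. -/
def rieszTransform (d : ℕ) (f : Rd d → ℝ) : Rd d → Rd d :=
  gradient (rieszPotential d 1 f)

/-- `Rf = F ∈ L¹(ℝ^d; ℝ^d)`: the integrable vector field `F` is the distributional gradient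
of `I_1 f`. (For `f ∈ L¹` the function `I_1 f` is locally integrable.) -/
def HasRieszTransform (d : ℕ) (f : Rd d → ℝ) (F : Rd d → Rd d) : Prop :=
  MeasureTheory.Integrable F ∧
    ∀ ψ : Rd d → ℝ, ContDiff ℝ (⊤ : ℕ∞) ψ → HasCompactSupport ψ → ∀ v : Rd d,
      ∫ x, rieszPotential d 1 f x * fderiv ℝ ψ x v = -∫ x, ψ x * inner ℝ (F x) v

/-- The unit vector field `x ↦ x / |x|` (with value `0` at the origin). -/
def unitField (d : ℕ) (x : Rd d) : Rd d := ‖x‖⁻¹ • x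

/-- Functions of bounded mean oscillation on `ℝ^d`. -/
def MemBMO (d : ℕ) (h : Rd d → ℝ) : Prop :=
  MeasureTheory.LocallyIntegrable h ∧
    ∃ C : ℝ, ∀ (c : Rd d) (r : ℝ), 0 < r →
      ⨍ x in Metric.ball c r, |h x - ⨍ y in Metric.ball c r, h y| ≤ C

/-- `h` is a representative of `R_j g ∈ BMO`, where `g ∈ L^∞`. As elements of `BMO` are classes
of functions modulo constants, `R_j g` is determined by its pairing with test functions `φ` of
mean zero, and `R_j` is antisymmetric: `⟨R_j g, φ⟩ = -⟨g, R_j φ⟩`. (For such `φ` the function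
`R_j φ` is `O(|x|^{-d-1})` at infinity, hence integrable.) -/
def IsRieszTransformBMO (d : ℕ) (j : Fin d) (g h : Rd d → ℝ) : Prop :=
  MemBMO d h ∧
    ∀ φ : Rd d → ℝ, ContDiff ℝ (⊤ : ℕ∞) φ → HasCompactSupport φ → ∫ x, φ x = 0 →
      ∫ x, h x * φ x = -∫ x, g x * rieszTransform d φ x j

/-- `g_j(x) = ((d-1) γ(d-1))⁻¹ x_j / |x|`. -/
def logDensity (d : ℕ) (j : Fin d) (x : Rd d) : ℝ :=
  1 / (((d : ℝ) - 1) * rieszGamma d ((d : ℝ) - 1)) * unitField d x j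

/-- `g_j(x) = ((d-1) γ(d-1))⁻¹ ∫_Ω (x_j - y_j) / |x-y| f(y) dy`. -/
def logPotentialDensity (d : ℕ) (Ω : Set (Rd d)) (f : Rd d → ℝ) (j : Fin d) (x : Rd d) : ℝ :=
  1 / (((d : ℝ) - 1) * rieszGamma d ((d : ℝ) - 1)) * ∫ y in Ω, unitField d (x - y) j * f y

end

namespace RieszLog

open MeasureTheory Metric Set Filter Topology

variable {n : ℕ}

/-- The kernel `|y|^{-n}` of `I_1` on `ℝ^{n+1}`, truncated to `|y| > 1`. -/
noncomputable def farKernel (n : ℕ) (y : Rd (n + 1)) : ℝ :=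
  if 1 < ‖y‖ then (‖y‖ ^ n)⁻¹ else 0

/-- The difference of the kernel of `I_1` with pole `w` and the truncated kernel. -/
noncomputable def diffKernel (n : ℕ) (y w : Rd (n + 1)) : ℝ :=
  (‖y - w‖ ^ n)⁻¹ - farKernel n y


lemma measurable_farKernel : Measurable (farKernel n) :=
  Measurable.ite (measurableSet_lt measurable_const measurable_norm) (by fun_prop)
    measurable_const

lemma measurable_diffKernel :
    Measurable (fun p : Rd (n + 1) × Rd (n + 1) => diffKernel n p.1 p.2) := by
  unfold diffKernel
  exact Measurable.sub (by fun_prop) (measurable_farKernel.comp measurable_fst)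

lemma locallyIntegrable_inv_norm_pow (k : ℕ) (hk : k ≤ n) :
    LocallyIntegrable (fun y : Rd (n + 1) => (‖y‖ ^ k)⁻¹) := by
  refine locallyIntegrable_of_norm_le_rpow (C := 1) (α := k) (by simp) ?_ ?_ ?_
  · simp; exact_mod_cast Nat.lt_succ_of_le hk
  · refine Eventually.of_forall fun y => ?_
    rw [Real.rpow_neg (norm_nonneg _), Real.rpow_natCast, one_mul, Real.norm_of_nonneg (by positivity)]
  · exact (by fun_prop : Measurable fun y : Rd (n + 1) => (‖y‖ ^ k)⁻¹).aestronglyMeasurable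

lemma locallyIntegrable_inv_norm (hn : 1 ≤ n) :
    LocallyIntegrable (fun y : Rd (n + 1) => ‖y‖⁻¹) := by
  simpa using locallyIntegrable_inv_norm_pow (n := n) 1 hn

lemma abs_log_le_add_inv {t : ℝ} (ht : 0 ≤ t) : |Real.log t| ≤ t + t⁻¹ := by
  rcases ht.eq_or_lt with rfl | ht
  · simp
  rw [abs_le]
  have h1 := Real.log_le_sub_one_of_pos ht
  have h2 := Real.log_le_sub_one_of_pos (inv_pos.2 ht)
  rw [Real.log_inv] at h2
  have := inv_pos.2 ht
  constructor <;> linarith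

lemma measurable_log_norm : Measurable (fun y : Rd (n + 1) => Real.log ‖y‖) :=
  Real.measurable_log.comp measurable_norm

lemma locallyIntegrable_log_norm (hn : 1 ≤ n) :
    LocallyIntegrable (fun y : Rd (n + 1) => Real.log ‖y‖) := by
  refine ((continuous_norm.locallyIntegrable).add (locallyIntegrable_inv_norm hn)).mono
    measurable_log_norm.aestronglyMeasurable (Eventually.of_forall fun y => ?_)
  simp only [Pi.add_apply]
  rw [Real.norm_eq_abs, Real.norm_of_nonneg (by positivity)]
  exact abs_log_le_add_inv (norm_nonneg _)

lemma integrableOn_ball {g : Rd (n + 1) → ℝ} (hg : LocallyIntegrable g) (c : Rd (n + 1)) (r : ℝ) :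
    IntegrableOn g (ball c r) :=
  (hg.integrableOn_isCompact (isCompact_closedBall c r)).mono_set ball_subset_closedBall

lemma integrable_indicator_ball {g : Rd (n + 1) → ℝ} (hg : LocallyIntegrable g)
    (c : Rd (n + 1)) (r : ℝ) : Integrable ((ball c r).indicator g) :=
  (integrable_indicator_iff measurableSet_ball).2 (integrableOn_ball hg c r)

/-- The area of the unit sphere of `ℝ^{n+1}`. -/
noncomputable def sphereArea (n : ℕ) : ℝ :=
  (n + 1) * volume.real (ball (0 : Rd (n + 1)) 1)

lemma sphereArea_eq :
    sphereArea n = 2 * Real.pi ^ (((n + 1 : ℕ) : ℝ) / 2) / Real.Gamma (((n + 1 : ℕ) : ℝ) / 2) := by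
  have h0 : (0 : ℝ) < ((n + 1 : ℕ) : ℝ) / 2 := by positivity
  have hG := Real.Gamma_pos_of_pos h0
  unfold sphereArea
  rw [Measure.real, EuclideanSpace.volume_ball]
  simp only [ENNReal.ofReal_one, one_pow, one_mul, Fintype.card_fin]
  rw [ENNReal.toReal_ofReal (by have := Real.Gamma_pos_of_pos (add_pos h0 one_pos); positivity),
    Real.Gamma_add_one h0.ne', Real.sqrt_eq_rpow, ← Real.rpow_natCast, ← Real.rpow_mul Real.pi_pos.le]
  have : (1 / 2 * ((n + 1 : ℕ) : ℝ)) = ((n + 1 : ℕ) : ℝ) / 2 := by ring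
  rw [this]
  field_simp
  push_cast
  ring

lemma sphereArea_pos : 0 < sphereArea n := by
  rw [sphereArea_eq]
  have := Real.Gamma_pos_of_pos (show (0 : ℝ) < ((n + 1 : ℕ) : ℝ) / 2 by positivity)
  have := Real.pi_pos
  positivity

lemma integral_radial (g : ℝ → ℝ) :
    ∫ x : Rd (n + 1), g ‖x‖ = sphereArea n * ∫ t in Ioi (0 : ℝ), t ^ n * g t := by
  rw [integral_fun_norm_addHaar]
  simp [sphereArea, mul_assoc]

lemma integrable_radial {g : ℝ → ℝ} :
    Integrable (fun x : Rd (n + 1) => g ‖x‖) ↔ IntegrableOn (fun t => t ^ n * g t) (Ioi 0) := by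
  rw [integrable_fun_norm_addHaar]
  simp

lemma rieszPotential_one (f : Rd (n + 1) → ℝ) (x : Rd (n + 1)) :
    rieszPotential (n + 1) 1 f x =
      (rieszGamma (n + 1) 1)⁻¹ * ∫ y, f y * (‖x - y‖ ^ n)⁻¹ := by
  unfold rieszPotential
  have : (((n + 1 : ℕ) : ℝ) - 1) = n := by push_cast; ring
  simp only [this, Real.rpow_natCast, div_eq_mul_inv, one_mul]

lemma rieszPotential_last (f : Rd (n + 1) → ℝ) (x : Rd (n + 1)) :
    rieszPotential (n + 1) (((n + 1 : ℕ) : ℝ) - 1) f x =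
      (rieszGamma (n + 1) n)⁻¹ * ∫ y, f y * ‖x - y‖⁻¹ := by
  unfold rieszPotential
  have : (((n + 1 : ℕ) : ℝ) - 1) = n := by push_cast; ring
  rw [this]
  have : (((n + 1 : ℕ) : ℝ) - n) = 1 := by push_cast; ring
  simp only [this, Real.rpow_one, div_eq_mul_inv, one_mul]

lemma rieszGamma_one_pos (hn : 1 ≤ n) : 0 < rieszGamma (n + 1) 1 := by
  unfold rieszGamma
  have hn' : (1 : ℝ) ≤ n := by exact_mod_cast hn
  have h1 := Real.Gamma_pos_of_pos (show (0 : ℝ) < 1 / 2 by norm_num)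
  have h2 := Real.Gamma_pos_of_pos (show (0 : ℝ) < (((n + 1 : ℕ) : ℝ) - 1) / 2 by
    push_cast; linarith)
  have := Real.pi_pos
  positivity

lemma rieszGamma_last_pos (hn : 1 ≤ n) : 0 < rieszGamma (n + 1) n := by
  unfold rieszGamma
  have hn' : (1 : ℝ) ≤ n := by exact_mod_cast hn
  have h1 := Real.Gamma_pos_of_pos (show (0 : ℝ) < n / 2 by linarith)
  have h2 := Real.Gamma_pos_of_pos (show (0 : ℝ) < (((n + 1 : ℕ) : ℝ) - n) / 2 by
    push_cast; linarith)
  have := Real.pi_pos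
  positivity

lemma rieszGamma_one_mul_last (hn : 1 ≤ n) :
    rieszGamma (n + 1) 1 * rieszGamma (n + 1) n = logGamma (n + 1) * sphereArea n := by
  rw [sphereArea_eq]
  unfold rieszGamma logGamma
  have hn' : (1 : ℝ) ≤ n := by exact_mod_cast hn
  have e1 : (((n + 1 : ℕ) : ℝ) - 1) = n := by push_cast; ring
  have e2 : (((n + 1 : ℕ) : ℝ) - n) = 1 := by push_cast; ring
  rw [e1, e2]
  have h1 := Real.Gamma_pos_of_pos (show (0 : ℝ) < 1 / 2 by norm_num)
  have h2 := Real.Gamma_pos_of_pos (show (0 : ℝ) < n / 2 by linarith)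
  have h3 := Real.Gamma_pos_of_pos (show (0 : ℝ) < ((n + 1 : ℕ) : ℝ) / 2 by positivity)
  have := Real.pi_pos
  field_simp
  simp

lemma logGamma_pos : 0 < logGamma (n + 1) := by
  unfold logGamma
  have h3 := Real.Gamma_pos_of_pos (show (0 : ℝ) < ((n + 1 : ℕ) : ℝ) / 2 by positivity)
  have := Real.pi_pos
  positivity

/-- The change of the truncated kernel when the truncation radius `1` becomes `r⁻¹`. -/
noncomputable def shellKernel (n : ℕ) (r : ℝ) (u : Rd (n + 1)) : ℝ :=
  (if 1 < ‖u‖ then (‖u‖ ^ n)⁻¹ else 0) - (if 1 < r * ‖u‖ then (‖u‖ ^ n)⁻¹ else 0)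

lemma measurable_shellKernel (r : ℝ) : Measurable (shellKernel n r) := by
  unfold shellKernel
  refine Measurable.sub (Measurable.ite (measurableSet_lt measurable_const measurable_norm)
    (by fun_prop) measurable_const) (Measurable.ite (measurableSet_lt measurable_const ?_)
    (by fun_prop) measurable_const)
  fun_prop

lemma shell_radial_eq {r t : ℝ} (hr : 0 < r) (ht : 0 < t) :
    t ^ n * (t⁻¹ * ((if 1 < t then (t ^ n)⁻¹ else 0) - (if 1 < r * t then (t ^ n)⁻¹ else 0))) =
      (Ioc 1 r⁻¹).indicator (fun t => t⁻¹) t - (Ioc r⁻¹ 1).indicator (fun t => t⁻¹) t := by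
  have h : 1 < r * t ↔ r⁻¹ < t := by rw [inv_lt_iff_one_lt_mul₀ hr, mul_comm]
  have ht' : t ^ n ≠ 0 := by positivity
  simp only [indicator, mem_Ioc, h]
  by_cases h1 : 1 < t <;> by_cases h2 : r⁻¹ < t
  · simp [h1, h2, not_le.2 h1, not_le.2 h2]
  · simp [h1, h2, not_lt.1 h2]; field_simp
  · simp [h1, h2, not_lt.1 h1]; field_simp
  · simp [h1, h2]

lemma integrableOn_shell_radial {r : ℝ} (hr : 0 < r) :
    IntegrableOn (fun t => (Ioc 1 r⁻¹).indicator (fun t => t⁻¹) t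
      - (Ioc r⁻¹ 1).indicator (fun t => t⁻¹) t) (Ioi (0 : ℝ)) := by
  have hi : IntervalIntegrable (fun t : ℝ => t⁻¹) volume 1 r⁻¹ :=
    intervalIntegral.intervalIntegrable_inv (fun x hx => by
      have := lt_of_lt_of_le (lt_min one_pos (inv_pos.2 hr)) hx.1
      exact this.ne') continuousOn_id
  exact (((integrable_indicator_iff measurableSet_Ioc).2 hi.1).sub
    ((integrable_indicator_iff measurableSet_Ioc).2 hi.2)).integrableOn

lemma integrable_shellKernel {r : ℝ} (hr : 0 < r) :
    Integrable (fun u : Rd (n + 1) => ‖u‖⁻¹ * shellKernel n r u) := by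
  refine (integrable_radial (g := fun t => t⁻¹ * ((if 1 < t then (t ^ n)⁻¹ else 0) -
    (if 1 < r * t then (t ^ n)⁻¹ else 0)))).2 ?_
  exact (integrableOn_shell_radial hr).congr_fun (fun t ht => (shell_radial_eq hr ht).symm)
    measurableSet_Ioi

lemma integral_shellKernel {r : ℝ} (hr : 0 < r) :
    ∫ u : Rd (n + 1), ‖u‖⁻¹ * shellKernel n r u = -(sphereArea n * Real.log r) := by
  have h := integral_radial (n := n) (fun t => t⁻¹ * ((if 1 < t then (t ^ n)⁻¹ else 0) -
    (if 1 < r * t then (t ^ n)⁻¹ else 0)))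
  refine h.trans ?_
  have hi : IntervalIntegrable (fun t : ℝ => t⁻¹) volume 1 r⁻¹ :=
    intervalIntegral.intervalIntegrable_inv (fun x hx => by
      have := lt_of_lt_of_le (lt_min one_pos (inv_pos.2 hr)) hx.1
      exact this.ne') continuousOn_id
  have hsub : ∀ a b : ℝ, 0 < a → Ioi (0 : ℝ) ∩ Ioc a b = Ioc a b := fun a b ha =>
    inter_eq_right.2 fun x hx => ha.trans hx.1
  rw [setIntegral_congr_fun measurableSet_Ioi (fun t ht => shell_radial_eq hr ht),
    integral_sub ((integrable_indicator_iff measurableSet_Ioc).2 hi.1).integrableOn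
      ((integrable_indicator_iff measurableSet_Ioc).2 hi.2).integrableOn,
    setIntegral_indicator measurableSet_Ioc, setIntegral_indicator measurableSet_Ioc,
    hsub _ _ one_pos, hsub _ _ (inv_pos.2 hr)]
  have := integral_inv_of_pos one_pos (inv_pos.2 hr)
  rw [intervalIntegral] at this
  rw [this]
  simp

lemma integral_abs_shellKernel {r : ℝ} (hr : 0 < r) :
    ∫ u : Rd (n + 1), ‖u‖⁻¹ * |shellKernel n r u| = sphereArea n * |Real.log r| := by
  have hσ := sphereArea_pos (n := n)
  rcases le_total r 1 with h | h
  · have : ∀ u, |shellKernel n r u| = shellKernel n r u := fun u => by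
      apply abs_of_nonneg
      unfold shellKernel
      have : 1 < r * ‖u‖ → 1 < ‖u‖ := fun h' => by nlinarith [norm_nonneg u]
      split_ifs with h1 h2 h2
      · simp
      · rw [sub_zero]; positivity
      · exact absurd (this h2) h1
      · simp
    simp_rw [this]
    rw [integral_shellKernel hr, abs_of_nonpos (Real.log_nonpos hr.le h)]
    ring
  · have : ∀ u, |shellKernel n r u| = -shellKernel n r u := fun u => by
      apply abs_of_nonpos
      unfold shellKernel
      have : 1 < ‖u‖ → 1 < r * ‖u‖ := fun h' => by nlinarith [norm_nonneg u]
      split_ifs with h1 h2 h2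
      · simp
      · exact absurd (this h1) h2
      · rw [zero_sub, neg_nonpos]; positivity
      · simp
    simp_rw [this, mul_neg]
    rw [integral_neg, integral_shellKernel hr, abs_of_nonneg (Real.log_nonneg h)]
    ring

lemma diffKernel_smul {r : ℝ} (hr : 0 < r) (u e : Rd (n + 1)) :
    diffKernel n (r • u) (r • e) = (r ^ n)⁻¹ * (diffKernel n u e + shellKernel n r u) := by
  unfold diffKernel shellKernel farKernel
  rw [← smul_sub, norm_smul, norm_smul, Real.norm_of_nonneg hr.le, mul_pow, mul_pow, mul_inv,
    mul_inv]
  split_ifs <;> ring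

lemma abs_inv_pow_sub_le {a b : ℝ} (hb : 0 < b) (ha : b / 2 ≤ a) :
    |(a ^ n)⁻¹ - (b ^ n)⁻¹| ≤ n * 2 ^ n * |a - b| * b⁻¹ ^ (n + 1) := by
  rcases Nat.eq_zero_or_pos n with rfl | hn
  · simp
  have ha' : 0 < a := lt_of_lt_of_le (by positivity) ha
  have hinv : a⁻¹ ≤ 2 * b⁻¹ := by
    have := inv_anti₀ (by positivity) ha
    rwa [inv_div, div_eq_mul_inv] at this
  have hb' := inv_pos.2 hb
  have ha'' := inv_pos.2 ha'
  rw [← inv_pow, ← inv_pow]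
  refine (abs_pow_sub_pow_le _ _ _).trans ?_
  have h1 : |a⁻¹ - b⁻¹| ≤ 2 * b⁻¹ * b⁻¹ * |a - b| := by
    rw [inv_sub_inv ha'.ne' hb.ne', abs_div, abs_sub_comm, abs_of_pos (mul_pos ha' hb),
      div_eq_mul_inv, mul_inv]
    have := abs_nonneg (a - b)
    calc |a - b| * (a⁻¹ * b⁻¹) ≤ |a - b| * (2 * b⁻¹ * b⁻¹) := by gcongr
      _ = _ := by ring
  have h2 : max |a⁻¹| |b⁻¹| ≤ 2 * b⁻¹ := by
    rw [abs_of_pos ha'', abs_of_pos hb']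
    exact max_le hinv (by linarith)
  calc |a⁻¹ - b⁻¹| * n * max |a⁻¹| |b⁻¹| ^ (n - 1)
      ≤ (2 * b⁻¹ * b⁻¹ * |a - b|) * n * (2 * b⁻¹) ^ (n - 1) := by gcongr
    _ = n * 2 ^ n * |a - b| * b⁻¹ ^ (n + 1) := by
      obtain ⟨k, rfl⟩ : ∃ k, n = k + 1 := ⟨n - 1, by omega⟩
      simp only [Nat.add_sub_cancel, mul_pow]
      ring

lemma integrable_one_add_norm_pow :
    Integrable (fun y : Rd (n + 1) => (1 + ‖y‖)⁻¹ ^ (n + 2)) := by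
  have := integrable_one_add_norm (E := Rd (n + 1)) (μ := volume) (r := ((n + 2 : ℕ) : ℝ))
    (by simp)
  refine this.congr (Eventually.of_forall fun y => ?_)
  simp only
  rw [Real.rpow_neg (by positivity), Real.rpow_natCast, inv_pow]

lemma inv_mul_abs_diffKernel_le (hn : 1 ≤ n) {e : Rd (n + 1)} (he : ‖e‖ = 1) (y : Rd (n + 1)) :
    ‖y‖⁻¹ * |diffKernel n y e| ≤
      (ball 0 3).indicator (fun y => 2 ^ n * ‖y‖⁻¹) y +
      (ball e 4).indicator (fun y => 2 * (‖y - e‖ ^ n)⁻¹) y +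
      (ball 0 3).indicator (fun _ => 1) y +
      n * 2 ^ n * 2 ^ (n + 2) * (1 + ‖y‖)⁻¹ ^ (n + 2) := by
  have hy0 := norm_nonneg y
  have i1 : 0 ≤ (ball (0 : Rd (n + 1)) 3).indicator (fun y => 2 ^ n * ‖y‖⁻¹) y :=
    indicator_nonneg (fun _ _ => by positivity) _
  have i2 : 0 ≤ (ball e 4).indicator (fun y => 2 * (‖y - e‖ ^ n)⁻¹) y :=
    indicator_nonneg (fun _ _ => by positivity) _
  have i3 : 0 ≤ (ball (0 : Rd (n + 1)) 3).indicator (fun _ => (1 : ℝ)) y :=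
    indicator_nonneg (fun _ _ => by positivity) _
  have i4 : 0 ≤ n * 2 ^ n * 2 ^ (n + 2) * (1 + ‖y‖)⁻¹ ^ (n + 2) := by positivity
  rcases le_or_gt ‖y‖ 2 with h | h
  · have m1 : y ∈ ball (0 : Rd (n + 1)) 3 := by simp; linarith
    have m2 : y ∈ ball e 4 := by
      rw [mem_ball, dist_eq_norm]; have := norm_sub_le y e; linarith
    rw [indicator_of_mem m1, indicator_of_mem m2, indicator_of_mem m1]
    have hfar : ‖y‖⁻¹ * |farKernel n y| ≤ 1 := by
      unfold farKernel
      split_ifs with h1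
      · rw [abs_of_nonneg (by positivity)]
        have : (‖y‖ ^ n)⁻¹ ≤ 1 := inv_le_one_of_one_le₀ (one_le_pow₀ h1.le)
        have : ‖y‖⁻¹ ≤ 1 := inv_le_one_of_one_le₀ h1.le
        exact mul_le_one₀ this (by positivity) (by assumption)
      · simp
    have hnear : ‖y‖⁻¹ * (‖y - e‖ ^ n)⁻¹ ≤ 2 ^ n * ‖y‖⁻¹ + 2 * (‖y - e‖ ^ n)⁻¹ := by
      rcases le_or_gt (1 / 2) ‖y‖ with h2 | h2
      · have : ‖y‖⁻¹ ≤ 2 := by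
          have := inv_anti₀ (by norm_num) h2; norm_num at this; exact this
        have : ‖y‖⁻¹ * (‖y - e‖ ^ n)⁻¹ ≤ 2 * (‖y - e‖ ^ n)⁻¹ := by gcongr
        have : 0 ≤ 2 ^ n * ‖y‖⁻¹ := by positivity
        linarith
      · have h3 : 1 / 2 ≤ ‖y - e‖ := by
          have := norm_sub_norm_le e y
          rw [norm_sub_rev] at this; linarith
        have : (‖y - e‖ ^ n)⁻¹ ≤ 2 ^ n := by
          rw [← inv_pow]
          refine pow_le_pow_left₀ (by positivity) ?_ _
          have := inv_anti₀ (by norm_num) h3; norm_num at this; exact this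
        have : ‖y‖⁻¹ * (‖y - e‖ ^ n)⁻¹ ≤ ‖y‖⁻¹ * 2 ^ n := by gcongr
        have : 0 ≤ 2 * (‖y - e‖ ^ n)⁻¹ := by positivity
        linarith
    have : |diffKernel n y e| ≤ (‖y - e‖ ^ n)⁻¹ + |farKernel n y| := by
      refine (abs_sub _ _).trans_eq ?_
      rw [abs_of_nonneg (by positivity : 0 ≤ (‖y - e‖ ^ n)⁻¹)]
    have := mul_le_mul_of_nonneg_left this (inv_nonneg.2 hy0)
    rw [mul_add] at this
    linarith
  · have hpos : 0 < ‖y‖ := by linarith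
    have h1 : |‖y - e‖ - ‖y‖| ≤ 1 := by
      have := abs_norm_sub_norm_le (y - e) y
      simpa [he] using this
    have h2 : ‖y‖ / 2 ≤ ‖y - e‖ := by
      have := (abs_le.1 h1).1; linarith
    have h3 := abs_inv_pow_sub_le (n := n) hpos h2
    have h4 : diffKernel n y e = (‖y - e‖ ^ n)⁻¹ - (‖y‖ ^ n)⁻¹ := by
      simp [diffKernel, farKernel, (by linarith : 1 < ‖y‖)]
    have h5 : ‖y‖⁻¹ ≤ 2 * (1 + ‖y‖)⁻¹ := by
      rw [← div_eq_mul_inv, inv_eq_one_div, div_le_div_iff₀ hpos (by linarith)]; linarith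
    have : ‖y‖⁻¹ * |diffKernel n y e| ≤ n * 2 ^ n * 2 ^ (n + 2) * (1 + ‖y‖)⁻¹ ^ (n + 2) := by
      rw [h4]
      calc _ ≤ ‖y‖⁻¹ * (n * 2 ^ n * 1 * ‖y‖⁻¹ ^ (n + 1)) := by
            gcongr; exact h3.trans (by gcongr)
        _ = n * 2 ^ n * ‖y‖⁻¹ ^ (n + 2) := by ring
        _ ≤ n * 2 ^ n * (2 * (1 + ‖y‖)⁻¹) ^ (n + 2) := by gcongr
        _ = _ := by rw [mul_pow]; ring
    linarith

lemma integrable_diffKernel_unit (hn : 1 ≤ n) {e : Rd (n + 1)} (he : ‖e‖ = 1) :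
    Integrable (fun y : Rd (n + 1) => ‖y‖⁻¹ * diffKernel n y e) := by
  have hk : LocallyIntegrable (fun y : Rd (n + 1) => (‖y - e‖ ^ n)⁻¹) := by
    refine locallyIntegrable_iff.2 fun k hk => ?_
    obtain ⟨R, -, hR⟩ := hk.isBounded.exists_pos_norm_lt
    have := integrableOn_ball (locallyIntegrable_inv_norm_pow (n := n) n le_rfl) 0 (R + 1)
    have hp := (measurePreserving_sub_right (volume : Measure (Rd (n + 1))) e)
    have h2 := (hp.integrableOn_comp_preimage (MeasurableEquiv.subRight e).measurableEmbedding).2 this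
    refine h2.mono_set fun y hy => ?_
    simp only [mem_preimage, mem_ball_zero_iff]
    have := norm_sub_le y e
    have := hR y hy
    linarith
  refine (((((integrable_indicator_ball (locallyIntegrable_inv_norm hn) 0 3).const_mul (2 ^ n)).add
    ((integrable_indicator_ball hk e 4).const_mul 2)).add
    (integrable_indicator_ball (g := fun _ => (1 : ℝ)) (locallyIntegrable_const 1) 0 3)).add
    (integrable_one_add_norm_pow.const_mul (n * 2 ^ n * 2 ^ (n + 2)))).mono' ?_ ?_
  · have := measurable_diffKernel (n := n).comp (measurable_id.prodMk (measurable_const (a := e)))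
    exact (measurable_norm.inv.mul this).aestronglyMeasurable
  · refine Eventually.of_forall fun y => ?_
    have := inv_mul_abs_diffKernel_le hn he y
    rw [norm_mul, norm_inv, norm_norm, Real.norm_eq_abs]
    refine this.trans_eq ?_
    simp only [Pi.add_apply, indicator]
    split_ifs <;> simp

/-- Measurable functions, homogeneous of degree `-1` and bounded by `|y|⁻¹`. -/
structure IsHomKernel (m : Rd (n + 1) → ℝ) : Prop where
  measurable : Measurable m
  abs_le : ∀ y, |m y| ≤ ‖y‖⁻¹
  smul : ∀ r : ℝ, 0 < r → ∀ y, m (r • y) = r⁻¹ * m y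

/-- The regularized potential `I_1 m` of a kernel `m` of degree `-1`. -/
noncomputable def logKernel (m : Rd (n + 1) → ℝ) (w : Rd (n + 1)) : ℝ :=
  ∫ y, m y * diffKernel n y w

/-- The derivative `∂_j (y_j / |y|)`. -/
noncomputable def unitFieldDeriv (n : ℕ) (j : Fin (n + 1)) (y : Rd (n + 1)) : ℝ :=
  ‖y‖⁻¹ - y j ^ 2 * ‖y‖⁻¹ ^ 3

lemma isHomKernel_inv_norm : IsHomKernel (fun y : Rd (n + 1) => ‖y‖⁻¹) where
  measurable := by fun_prop
  abs_le y := by rw [abs_of_nonneg (by positivity)]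
  smul r hr y := by rw [norm_smul, Real.norm_of_nonneg hr.le, mul_inv]

lemma abs_apply_le_norm (y : Rd (n + 1)) (j : Fin (n + 1)) : |y j| ≤ ‖y‖ := by
  simpa using PiLp.norm_apply_le y j

lemma sq_mul_inv_cube_le (y : Rd (n + 1)) (j : Fin (n + 1)) : y j ^ 2 * ‖y‖⁻¹ ^ 3 ≤ ‖y‖⁻¹ := by
  rcases (norm_nonneg y).eq_or_lt with h | h
  · simp [← h]
  · have := sq_le_sq' (abs_le.1 (abs_apply_le_norm y j)).1 (abs_le.1 (abs_apply_le_norm y j)).2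
    calc y j ^ 2 * ‖y‖⁻¹ ^ 3 ≤ ‖y‖ ^ 2 * ‖y‖⁻¹ ^ 3 := by gcongr
      _ = ‖y‖⁻¹ := by field_simp

lemma isHomKernel_unitFieldDeriv (j : Fin (n + 1)) : IsHomKernel (unitFieldDeriv n j) where
  measurable := by unfold unitFieldDeriv; fun_prop
  abs_le y := by
    have := sq_mul_inv_cube_le y j
    have : 0 ≤ y j ^ 2 * ‖y‖⁻¹ ^ 3 := by positivity
    unfold unitFieldDeriv
    rw [abs_of_nonneg (by linarith)]
    linarith
  smul r hr y := by
    simp only [unitFieldDeriv, norm_smul, Real.norm_of_nonneg hr.le, PiLp.smul_apply, smul_eq_mul]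
    field_simp

lemma sum_unitFieldDeriv (y : Rd (n + 1)) : ∑ j, unitFieldDeriv n j y = n * ‖y‖⁻¹ := by
  simp only [unitFieldDeriv, Finset.sum_sub_distrib, ← Finset.sum_mul]
  have : ∑ j, y j ^ 2 = ‖y‖ ^ 2 := by rw [EuclideanSpace.real_norm_sq_eq]
  rw [this]
  rcases (norm_nonneg y).eq_or_lt with h | h
  · simp [← h]
  · simp
    field_simp
    ring

lemma exists_smul_unit (w : Rd (n + 1)) (hw : w ≠ 0) :
    ∃ e : Rd (n + 1), ‖e‖ = 1 ∧ w = ‖w‖ • e :=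
  ⟨‖w‖⁻¹ • w, by simp [norm_smul, hw], by simp [smul_smul, hw]⟩

lemma measurable_diffKernel_left (w : Rd (n + 1)) : Measurable (fun y => diffKernel n y w) := by
  unfold diffKernel
  exact Measurable.sub (by fun_prop) measurable_farKernel

/-- Change of variables in integrals of the difference kernel. -/
lemma integral_diffKernel_smul {m : Rd (n + 1) → ℝ}
    (hm : ∀ r : ℝ, 0 < r → ∀ y, m (r • y) = r⁻¹ * m y)
    {F : ℝ → ℝ} (hF : ∀ r : ℝ, 0 < r → ∀ t, F (r * t) = r * F t) {r : ℝ} (hr : 0 < r)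
    (e : Rd (n + 1)) :
    ∫ y, m y * F (diffKernel n y (r • e)) =
      ∫ u, m u * F (diffKernel n u e + shellKernel n r u) := by
  have h := Measure.integral_comp_smul (volume : Measure (Rd (n + 1)))
    (fun y => m y * F (diffKernel n y (r • e))) r
  have hr' : (0 : ℝ) < r ^ (n + 1) := by positivity
  have h2 : ∀ u, m (r • u) * F (diffKernel n (r • u) (r • e)) =
      (r ^ (n + 1))⁻¹ * (m u * F (diffKernel n u e + shellKernel n r u)) := fun u => by
    rw [diffKernel_smul hr, hF _ (by positivity), hm r hr, pow_succ, mul_inv]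
    ring
  simp only [h2, integral_const_mul] at h
  rw [finrank_euclideanSpace, Fintype.card_fin, abs_of_pos (inv_pos.2 hr'), smul_eq_mul] at h
  exact (mul_left_cancel₀ (inv_pos.2 hr').ne' h).symm

lemma integrable_mul_of_homKernel {m g : Rd (n + 1) → ℝ} (hm : IsHomKernel m) (hg : Measurable g)
    (h : Integrable (fun y => ‖y‖⁻¹ * g y)) : Integrable (fun y => m y * g y) := by
  refine h.mono (hm.measurable.mul hg).aestronglyMeasurable (Eventually.of_forall fun y => ?_)
  rw [norm_mul, norm_mul, norm_inv, norm_norm]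
  exact mul_le_mul_of_nonneg_right (hm.abs_le y) (norm_nonneg _)

lemma integrable_diffKernel (hn : 1 ≤ n) {w : Rd (n + 1)} (hw : w ≠ 0) :
    Integrable (fun y => ‖y‖⁻¹ * diffKernel n y w) := by
  obtain ⟨e, he, hwe⟩ := exists_smul_unit w hw
  have hr : 0 < ‖w‖ := norm_pos_iff.2 hw
  generalize ‖w‖ = r at hwe hr
  subst hwe
  rw [← integrable_comp_smul_iff volume _ hr.ne']
  have h := ((integrable_diffKernel_unit hn he).add (integrable_shellKernel hr)).const_mul
    ((r ^ (n + 1))⁻¹)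
  refine h.congr (Eventually.of_forall fun u => ?_)
  simp only [Pi.add_apply]
  rw [norm_smul, Real.norm_of_nonneg hr.le, diffKernel_smul hr, mul_inv, pow_succ, mul_inv]
  ring

lemma integrable_homKernel_mul_diffKernel (hn : 1 ≤ n) {m : Rd (n + 1) → ℝ} (hm : IsHomKernel m)
    {w : Rd (n + 1)} (hw : w ≠ 0) : Integrable (fun y => m y * diffKernel n y w) :=
  integrable_mul_of_homKernel hm (measurable_diffKernel_left w) (integrable_diffKernel hn hw)

lemma logKernel_smul (hn : 1 ≤ n) {m : Rd (n + 1) → ℝ} (hm : IsHomKernel m) {r : ℝ} (hr : 0 < r)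
    {e : Rd (n + 1)} (he : ‖e‖ = 1) :
    logKernel m (r • e) = logKernel m e + ∫ u, m u * shellKernel n r u := by
  have he0 : e ≠ 0 := by rintro rfl; simp at he
  have h := integral_diffKernel_smul hm.smul (F := id) (fun _ _ _ => rfl) hr e
  simp only [id] at h
  rw [logKernel, h, logKernel, ← integral_add (integrable_homKernel_mul_diffKernel hn hm he0)
    (integrable_mul_of_homKernel hm (measurable_shellKernel r) (integrable_shellKernel hr))]
  simp only [mul_add]

lemma exists_isometry_of_norm_eq {v w : Rd (n + 1)} (h : ‖v‖ = ‖w‖) :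
    ∃ T : Rd (n + 1) ≃ₗᵢ[ℝ] Rd (n + 1), T v = w :=
  ⟨(ℝ ∙ (v - w))ᗮ.reflection, Submodule.reflection_sub h⟩

lemma diffKernel_isometry (T : Rd (n + 1) ≃ₗᵢ[ℝ] Rd (n + 1)) (y w : Rd (n + 1)) :
    diffKernel n (T y) (T w) = diffKernel n y w := by
  simp [diffKernel, farKernel, ← map_sub]

lemma integral_isometry (T : Rd (n + 1) ≃ₗᵢ[ℝ] Rd (n + 1)) (g : Rd (n + 1) → ℝ) :
    ∫ y, g (T y) = ∫ y, g y :=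
  T.measurePreserving.integral_comp T.toHomeomorph.measurableEmbedding g

lemma integral_diffKernel_rotation (F : ℝ → ℝ) {v w : Rd (n + 1)} (h : ‖v‖ = ‖w‖) :
    ∫ y, ‖y‖⁻¹ * F (diffKernel n y v) = ∫ y, ‖y‖⁻¹ * F (diffKernel n y w) := by
  obtain ⟨T, hT⟩ := exists_isometry_of_norm_eq h
  rw [← integral_isometry T (fun y => ‖y‖⁻¹ * F (diffKernel n y w))]
  simp only [← hT, diffKernel_isometry, T.norm_map]

lemma integral_unitFieldDeriv_mul_radial (g : ℝ → ℝ)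
    (hg : Integrable (fun y : Rd (n + 1) => ‖y‖⁻¹ * g ‖y‖)) (hgm : Measurable g)
    (j : Fin (n + 1)) :
    ∫ y, unitFieldDeriv n j y * g ‖y‖ = n / (n + 1) * ∫ y : Rd (n + 1), ‖y‖⁻¹ * g ‖y‖ := by
  have hsymm : ∀ i : Fin (n + 1),
      ∫ y, unitFieldDeriv n i y * g ‖y‖ = ∫ y, unitFieldDeriv n j y * g ‖y‖ := fun i => by
    let T : Rd (n + 1) ≃ₗᵢ[ℝ] Rd (n + 1) := LinearIsometryEquiv.piLpCongrLeft 2 ℝ ℝ (Equiv.swap i j)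
    rw [← integral_isometry T]
    congr 1
    ext y
    have : (T y) i = y j := by simp [T, Equiv.piCongrLeft'_apply]
    simp only [unitFieldDeriv, T.norm_map, this]
  have hi : ∀ i, Integrable (fun y => unitFieldDeriv n i y * g ‖y‖) := fun i =>
    integrable_mul_of_homKernel (isHomKernel_unitFieldDeriv i) (hgm.comp measurable_norm) hg
  have hsum : ∑ i, ∫ y, unitFieldDeriv n i y * g ‖y‖ = n * ∫ y : Rd (n + 1), ‖y‖⁻¹ * g ‖y‖ := by
    rw [← integral_finsetSum _ (fun i _ => hi i), ← integral_const_mul]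
    congr 1
    ext y
    rw [← Finset.sum_mul, sum_unitFieldDeriv]
    ring
  simp only [hsymm, Finset.sum_const, Finset.card_univ, Fintype.card_fin, nsmul_eq_mul] at hsum
  push_cast at hsum
  have : (n + 1 : ℝ) ≠ 0 := by positivity
  rw [div_mul_eq_mul_div, eq_div_iff this, ← hsum]
  ring

/-- The constant term of the potential of `|y|⁻¹`. -/
noncomputable def kernelConst (n : ℕ) : ℝ :=
  logKernel (fun y : Rd (n + 1) => ‖y‖⁻¹) (EuclideanSpace.single 0 1)

/-- The integral of the absolute value of the difference kernel for a unit pole. -/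
noncomputable def absKernelConst (n : ℕ) : ℝ :=
  ∫ y : Rd (n + 1), ‖y‖⁻¹ * |diffKernel n y (EuclideanSpace.single 0 1)|

lemma logKernel_inv_norm (hn : 1 ≤ n) {w : Rd (n + 1)} (hw : w ≠ 0) :
    logKernel (fun y : Rd (n + 1) => ‖y‖⁻¹) w = kernelConst n - sphereArea n * Real.log ‖w‖ := by
  obtain ⟨e, he, hwe⟩ := exists_smul_unit w hw
  have hr : 0 < ‖w‖ := norm_pos_iff.2 hw
  conv_lhs => rw [hwe]
  rw [logKernel_smul hn isHomKernel_inv_norm hr he, integral_shellKernel hr, ← sub_eq_add_neg]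
  congr 1
  exact integral_diffKernel_rotation id (by simp [he])

lemma integral_abs_diffKernel_unit {e : Rd (n + 1)} (he : ‖e‖ = 1) :
    ∫ y, ‖y‖⁻¹ * |diffKernel n y e| = absKernelConst n :=
  integral_diffKernel_rotation _ (by simp [he])

lemma integral_abs_diffKernel_le (hn : 1 ≤ n) {w : Rd (n + 1)} (hw : w ≠ 0) :
    ∫ y, ‖y‖⁻¹ * |diffKernel n y w| ≤ absKernelConst n + sphereArea n * |Real.log ‖w‖| := by
  obtain ⟨e, he, hwe⟩ := exists_smul_unit w hw
  have hr : 0 < ‖w‖ := norm_pos_iff.2 hw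
  have habs : ∀ g : Rd (n + 1) → ℝ, Integrable (fun y => ‖y‖⁻¹ * g y) →
      Integrable (fun y => ‖y‖⁻¹ * |g y|) := fun g hg => by
    refine hg.abs.congr (Eventually.of_forall fun y => ?_)
    simp only
    rw [abs_mul, abs_of_nonneg (by positivity : 0 ≤ ‖y‖⁻¹)]
  have i1 := habs _ (integrable_diffKernel_unit hn he)
  have i2 := habs _ (integrable_shellKernel (n := n) hr)
  have h := integral_diffKernel_smul (m := fun y : Rd (n + 1) => ‖y‖⁻¹) isHomKernel_inv_norm.smul
    (F := abs) (fun r hr t => by rw [abs_mul, abs_of_pos hr]) hr e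
  rw [← hwe] at h
  rw [h, ← integral_abs_shellKernel hr, ← integral_abs_diffKernel_unit he, ← integral_add i1 i2]
  refine integral_mono (habs _ ?_) (i1.add i2) fun y => ?_
  · simp only [mul_add]
    exact (integrable_diffKernel_unit hn he).add (integrable_shellKernel hr)
  · simp only
    rw [← mul_add]
    gcongr
    exact abs_add_le _ _

lemma abs_logKernel_unit_le (hn : 1 ≤ n) {m : Rd (n + 1) → ℝ} (hm : IsHomKernel m)
    {e : Rd (n + 1)} (he : ‖e‖ = 1) : |logKernel m e| ≤ absKernelConst n := by
  rw [← integral_abs_diffKernel_unit he]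
  refine (abs_integral_le_integral_abs).trans ?_
  have he0 : e ≠ 0 := by rintro rfl; simp at he
  have hi := (integrable_diffKernel_unit hn he).abs
  refine integral_mono (integrable_homKernel_mul_diffKernel hn hm he0).abs ?_ fun y => ?_
  · refine hi.congr (Eventually.of_forall fun y => ?_)
    simp only
    rw [abs_mul, abs_of_nonneg (by positivity : 0 ≤ ‖y‖⁻¹)]
  · simp only
    rw [abs_mul]
    gcongr
    exact hm.abs_le y

/-- The regularized potential of `∂_j (y_j / |y|)` is a multiple of the logarithm plus a bounded
function. -/
lemma abs_logKernel_unitFieldDeriv_add_log_le (hn : 1 ≤ n) (j : Fin (n + 1)) {w : Rd (n + 1)}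
    (hw : w ≠ 0) :
    |logKernel (unitFieldDeriv n j) w + n / (n + 1) * sphereArea n * Real.log ‖w‖| ≤
      absKernelConst n := by
  obtain ⟨e, he, hwe⟩ := exists_smul_unit w hw
  have hr : 0 < ‖w‖ := norm_pos_iff.2 hw
  have h := logKernel_smul hn (isHomKernel_unitFieldDeriv j) hr he
  have h2 := integral_unitFieldDeriv_mul_radial (n := n)
    (fun t => (if 1 < t then (t ^ n)⁻¹ else 0) - (if 1 < ‖w‖ * t then (t ^ n)⁻¹ else 0))
    (integrable_shellKernel hr) ?_ j
  · rw [← hwe] at h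
    have h3 := integral_shellKernel (n := n) hr
    simp only [shellKernel] at h h3
    rw [h, h2, h3]
    have := abs_logKernel_unit_le hn (isHomKernel_unitFieldDeriv j) he
    convert this using 2
    ring
  · refine Measurable.sub (Measurable.ite (measurableSet_lt measurable_const measurable_id)
      (by fun_prop) measurable_const) (Measurable.ite (measurableSet_lt measurable_const ?_)
      (by fun_prop) measurable_const)
    fun_prop

lemma measurable_logKernel {m : Rd (n + 1) → ℝ} (hm : IsHomKernel m) :
    Measurable (logKernel m) := by
  have : StronglyMeasurable fun p : Rd (n + 1) × Rd (n + 1) => m p.2 * diffKernel n p.2 p.1 :=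
    ((hm.measurable.comp measurable_snd).mul
      (measurable_diffKernel.comp measurable_swap)).stronglyMeasurable
  exact this.integral_prod_right.measurable

lemma sum_logKernel_unitFieldDeriv (hn : 1 ≤ n) {w : Rd (n + 1)} (hw : w ≠ 0) :
    ∑ j, logKernel (unitFieldDeriv n j) w =
      n * (kernelConst n - sphereArea n * Real.log ‖w‖) := by
  rw [← logKernel_inv_norm hn hw]
  simp only [logKernel]
  rw [← integral_finsetSum _ (fun j _ =>
    integrable_homKernel_mul_diffKernel hn (isHomKernel_unitFieldDeriv j) hw), ← integral_const_mul]
  congr 1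
  ext y
  rw [← Finset.sum_mul, sum_unitFieldDeriv]
  ring

lemma ae_ne_point (x : Rd (n + 1)) : ∀ᵐ z : Rd (n + 1), z ≠ x :=
  (measure_eq_zero_iff_ae_notMem.1 (measure_singleton x)).mono fun z hz => by simpa using hz

lemma ae_integrable_log_mul (hn : 1 ≤ n) {f : Rd (n + 1) → ℝ} (hf : Integrable f)
    (hlog : Integrable (fun y => Real.log (1 + ‖y‖) * f y)) :
    ∀ᵐ x : Rd (n + 1), Integrable (fun y => Real.log (1 / ‖x - y‖) * f y) := by
  have hk := integrable_indicator_ball (locallyIntegrable_log_norm hn) 0 1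
  filter_upwards [hf.ae_convolution_exists (ContinuousLinearMap.mul ℝ ℝ) hk] with x hx
  have hx' : Integrable fun y => f y * (ball (0 : Rd (n + 1)) 1).indicator
    (fun y => Real.log ‖y‖) (x - y) := hx
  refine ((hx'.norm.add (hf.norm.const_mul (Real.log (1 + ‖x‖)))).add hlog.norm).mono'
    (AEStronglyMeasurable.mul ?_ hf.aestronglyMeasurable) (Eventually.of_forall fun y => ?_)
  · exact (Real.measurable_log.comp (by fun_prop)).aestronglyMeasurable
  · simp only [Pi.add_apply, norm_mul, one_div, Real.log_inv, norm_neg, Real.norm_eq_abs]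
    have h1 : 0 ≤ Real.log (1 + ‖x‖) := Real.log_nonneg (by linarith [norm_nonneg x])
    have h2 : 0 ≤ Real.log (1 + ‖y‖) := Real.log_nonneg (by linarith [norm_nonneg y])
    rw [abs_of_nonneg h2]
    have : |Real.log ‖x - y‖| ≤ |(ball (0 : Rd (n + 1)) 1).indicator (fun y => Real.log ‖y‖) (x - y)|
        + Real.log (1 + ‖x‖) + Real.log (1 + ‖y‖) := by
      rcases lt_or_ge ‖x - y‖ 1 with h | h
      · rw [indicator_of_mem (by simpa using h)]
        linarith
      · rw [abs_of_nonneg (Real.log_nonneg h)]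
        have h3 : ‖x - y‖ ≤ (1 + ‖x‖) * (1 + ‖y‖) := by
          nlinarith [norm_sub_le x y, norm_nonneg x, norm_nonneg y]
        have h4 := Real.log_le_log (by linarith) h3
        rw [Real.log_mul (by positivity) (by positivity)] at h4
        have := abs_nonneg ((ball (0 : Rd (n + 1)) 1).indicator (fun y => Real.log ‖y‖) (x - y))
        linarith
    calc _ ≤ _ := mul_le_mul_of_nonneg_right this (abs_nonneg (f y))
      _ = _ := by ring

/-- Composition `I_{d-1} I_1` against a kernel of degree `-1`, for functions of mean zero. -/
lemma riesz_fubini (hn : 1 ≤ n) {m f : Rd (n + 1) → ℝ} (hm : IsHomKernel m) (hf : Integrable f)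
    (h0 : ∫ y, f y = 0) {x : Rd (n + 1)}
    (hx : Integrable (fun y => Real.log (1 / ‖x - y‖) * f y)) :
    Integrable (fun y => rieszPotential (n + 1) 1 f y * m (y - x)) ∧
    Integrable (fun z => f z * logKernel m (z - x)) ∧
    ∫ y, rieszPotential (n + 1) 1 f y * m (y - x) =
      (rieszGamma (n + 1) 1)⁻¹ * ∫ z, f z * logKernel m (z - x) := by
  let G : Rd (n + 1) × Rd (n + 1) → ℝ :=
    fun p => f p.2 * (m (p.1 - x) * diffKernel n (p.1 - x) (p.2 - x))
  have hmeas : AEStronglyMeasurable G (volume.prod volume) := by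
    refine hf.aestronglyMeasurable.comp_snd.mul (Measurable.aestronglyMeasurable ?_)
    refine (hm.measurable.comp (by fun_prop)).mul ?_
    unfold diffKernel
    exact Measurable.sub (by fun_prop) (measurable_farKernel.comp (by fun_prop))
  have hslice : ∀ z, z ≠ x →
      Integrable (fun y => m (y - x) * diffKernel n (y - x) (z - x)) := fun z hz =>
    (integrable_homKernel_mul_diffKernel hn hm (sub_ne_zero.2 hz)).comp_sub_right x
  have hG : Integrable G (volume.prod volume) := by
    refine (integrable_prod_iff' hmeas).2 ⟨?_, ?_⟩
    · filter_upwards [ae_ne_point x] with z hz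
      exact (hslice z hz).const_mul (f z)
    · refine ((hf.norm.const_mul (absKernelConst n)).add
        (hx.norm.const_mul (sphereArea n))).mono' hmeas.norm.prod_swap.integral_prod_right' ?_
      filter_upwards [ae_ne_point x] with z hz
      have hz' := sub_ne_zero.2 hz
      rw [Real.norm_of_nonneg (integral_nonneg fun _ => norm_nonneg _)]
      simp only [G, norm_mul, integral_const_mul, Pi.add_apply, Real.norm_eq_abs, one_div,
        Real.log_inv, abs_neg]
      rw [integral_sub_right_eq_self (fun y => |m y| * |diffKernel n y (z - x)|) x]
      have h1 : ∫ y, |m y| * |diffKernel n y (z - x)| ≤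
          absKernelConst n + sphereArea n * |Real.log ‖z - x‖| := by
        refine le_trans ?_ (integral_abs_diffKernel_le hn hz')
        have i1 := (integrable_homKernel_mul_diffKernel hn hm hz').abs
        have i2 := (integrable_diffKernel hn hz').abs
        simp only [abs_mul, abs_inv, abs_norm] at i1 i2
        exact integral_mono i1 i2 fun y =>
          mul_le_mul_of_nonneg_right (hm.abs_le y) (abs_nonneg _)
      rw [norm_sub_rev x z]
      calc _ ≤ |f z| * (absKernelConst n + sphereArea n * |Real.log ‖z - x‖|) := by gcongr
        _ = _ := by ring
  have hγ := rieszGamma_one_pos hn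
  have hleft : ∀ᵐ y, ∫ z, G (y, z) =
      rieszGamma (n + 1) 1 * (rieszPotential (n + 1) 1 f y * m (y - x)) := by
    filter_upwards [hG.prod_right_ae] with y hy
    rcases eq_or_ne (m (y - x)) 0 with h | h
    · simp [G, h]
    · have h1 : Integrable (fun z => f z * diffKernel n (y - x) (z - x)) := by
        refine (hy.const_mul (m (y - x))⁻¹).congr (Eventually.of_forall fun z => ?_)
        simp only [G]
        field_simp
      have h2 : Integrable (fun z => f z * (‖y - z‖ ^ n)⁻¹) := by
        refine (h1.add (hf.mul_const (farKernel n (y - x)))).congr (Eventually.of_forall fun z => ?_)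
        simp only [diffKernel, Pi.add_apply, sub_sub_sub_cancel_right]
        ring
      have h3 : ∫ z, f z * diffKernel n (y - x) (z - x) = ∫ z, f z * (‖y - z‖ ^ n)⁻¹ := by
        simp only [diffKernel, sub_sub_sub_cancel_right, mul_sub]
        rw [integral_sub h2 (hf.mul_const _), integral_mul_const, h0]
        ring
      rw [rieszPotential_one, ← h3]
      simp only [G]
      rw [← integral_const_mul, ← integral_mul_const, ← integral_const_mul]
      congr 1
      ext z
      field_simp
  have hright : ∀ z, ∫ y, G (y, z) = f z * logKernel m (z - x) := fun z => by
    simp only [G, integral_const_mul, logKernel]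
    rw [integral_sub_right_eq_self (fun y => m y * diffKernel n y (z - x)) x]
  refine ⟨?_, ?_, ?_⟩
  · refine ((hG.integral_prod_left.congr hleft).const_mul (rieszGamma (n + 1) 1)⁻¹).congr
      (Eventually.of_forall fun y => ?_)
    simp only
    field_simp
  · exact hG.integral_prod_right.congr (Eventually.of_forall hright)
  · have h := integral_integral_swap (f := fun y z => G (y, z)) hG
    rw [integral_congr_ae hleft, integral_const_mul] at h
    simp only [hright] at h
    rw [← h]
    field_simp

lemma integrable_inv_norm_sub_pow_indicator (z : Rd (n + 1)) :
    Integrable ((ball z 1).indicator fun y => (‖y - z‖ ^ n)⁻¹) ∧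
    ∫ y, (ball z 1).indicator (fun y => (‖y - z‖ ^ n)⁻¹) y =
      ∫ y in ball (0 : Rd (n + 1)) 1, (‖y‖ ^ n)⁻¹ := by
  have h := integrable_indicator_ball (locallyIntegrable_inv_norm_pow (n := n) n le_rfl) 0 1
  have e : ((ball z 1).indicator fun y => (‖y - z‖ ^ n)⁻¹) =
      fun y => (ball (0 : Rd (n + 1)) 1).indicator (fun y => (‖y‖ ^ n)⁻¹) (y - z) := by
    ext y
    simp [indicator, dist_eq_norm]
  refine ⟨e ▸ h.comp_sub_right z, ?_⟩
  rw [e, integral_sub_right_eq_self, integral_indicator measurableSet_ball]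

/-- Potentials of bounded integrable functions are uniformly absolutely convergent. -/
lemma integral_abs_mul_inv_norm_sub_pow_le {D : Rd (n + 1) → ℝ} (hD : Integrable D) {B : ℝ}
    (hB : ∀ y, |D y| ≤ B) (z : Rd (n + 1)) :
    Integrable (fun y => D y * (‖y - z‖ ^ n)⁻¹) ∧
    ∫ y, |D y * (‖y - z‖ ^ n)⁻¹| ≤
      B * (∫ y in ball (0 : Rd (n + 1)) 1, (‖y‖ ^ n)⁻¹) + ∫ y, |D y| := by
  have hB0 : 0 ≤ B := (abs_nonneg _).trans (hB 0)
  obtain ⟨hi, hI⟩ := integrable_inv_norm_sub_pow_indicator z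
  have hle : ∀ y, |D y * (‖y - z‖ ^ n)⁻¹| ≤
      B * (ball z 1).indicator (fun y => (‖y - z‖ ^ n)⁻¹) y + |D y| := fun y => by
    rw [abs_mul, abs_of_nonneg (by positivity : 0 ≤ (‖y - z‖ ^ n)⁻¹)]
    rcases lt_or_ge ‖y - z‖ 1 with h | h
    · rw [indicator_of_mem (by simpa [dist_eq_norm] using h)]
      have := hB y
      have : |D y| * (‖y - z‖ ^ n)⁻¹ ≤ B * (‖y - z‖ ^ n)⁻¹ := by gcongr
      linarith [abs_nonneg (D y)]
    · rw [indicator_of_notMem (by simpa [dist_eq_norm] using h)]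
      have : (‖y - z‖ ^ n)⁻¹ ≤ 1 := inv_le_one_of_one_le₀ (one_le_pow₀ h)
      have : |D y| * (‖y - z‖ ^ n)⁻¹ ≤ |D y| * 1 := by gcongr
      linarith
  have hdom := (hi.const_mul B).add hD.abs
  have hint : Integrable (fun y => D y * (‖y - z‖ ^ n)⁻¹) :=
    hdom.mono' (hD.aestronglyMeasurable.mul (Measurable.aestronglyMeasurable (by fun_prop)))
      (Eventually.of_forall hle)
  refine ⟨hint, (integral_mono hint.abs hdom hle).trans_eq ?_⟩
  simp only [Pi.add_apply]
  rw [integral_add (hi.const_mul B) hD.abs, integral_const_mul, hI]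

/-- The Riesz potential `I_1` is symmetric. -/
lemma integral_rieszPotential_mul {f D : Rd (n + 1) → ℝ} (hf : Integrable f) (hD : Integrable D)
    {B : ℝ} (hB : ∀ y, |D y| ≤ B) :
    Integrable (fun y => rieszPotential (n + 1) 1 f y * D y) ∧
    ∫ y, rieszPotential (n + 1) 1 f y * D y =
      (rieszGamma (n + 1) 1)⁻¹ * ∫ z, f z * ∫ y, D y * (‖y - z‖ ^ n)⁻¹ := by
  let G : Rd (n + 1) × Rd (n + 1) → ℝ := fun p => f p.2 * (D p.1 * (‖p.1 - p.2‖ ^ n)⁻¹)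
  have hmeas : AEStronglyMeasurable G (volume.prod volume) :=
    hf.aestronglyMeasurable.comp_snd.mul (hD.aestronglyMeasurable.comp_fst.mul
      (Measurable.aestronglyMeasurable (by fun_prop)))
  have hG : Integrable G (volume.prod volume) := by
    refine (integrable_prod_iff' hmeas).2 ⟨Eventually.of_forall fun z =>
      (integral_abs_mul_inv_norm_sub_pow_le hD hB z).1.const_mul (f z), ?_⟩
    refine (hf.norm.mul_const (B * (∫ y in ball (0 : Rd (n + 1)) 1, (‖y‖ ^ n)⁻¹) + ∫ y, |D y|)).mono'
      hmeas.norm.prod_swap.integral_prod_right' (Eventually.of_forall fun z => ?_)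
    rw [Real.norm_of_nonneg (integral_nonneg fun _ => norm_nonneg _)]
    simp only [G]
    simp_rw [norm_mul (f z)]
    rw [integral_const_mul]
    exact mul_le_mul_of_nonneg_left (integral_abs_mul_inv_norm_sub_pow_le hD hB z).2 (norm_nonneg _)
  have hleft : ∀ y, (rieszGamma (n + 1) 1)⁻¹ * ∫ z, G (y, z) =
      rieszPotential (n + 1) 1 f y * D y := fun y => by
    rw [rieszPotential_one, mul_assoc, ← integral_mul_const]
    congr 2
    ext z
    simp only [G]
    ring
  refine ⟨(hG.integral_prod_left.const_mul (rieszGamma (n + 1) 1)⁻¹).congr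
    (Eventually.of_forall hleft), ?_⟩
  simp_rw [← hleft]
  rw [integral_const_mul, integral_integral_swap (f := fun y z => G (y, z)) hG]
  simp only [G, integral_const_mul]

lemma hasFDerivAt_sqrt_norm_sq_add (a : ℝ) {w : Rd (n + 1)} (h : ‖w‖ ^ 2 + a ≠ 0) :
    HasFDerivAt (fun w : Rd (n + 1) => √(‖w‖ ^ 2 + a))
      ((√(‖w‖ ^ 2 + a))⁻¹ • innerSL ℝ w) w := by
  have h1 : HasFDerivAt (fun w : Rd (n + 1) => ‖w‖ ^ 2 + a) (2 • innerSL ℝ w) w :=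
    (hasStrictFDerivAt_norm_sq w).hasFDerivAt.add_const a
  have h2 := h1.sqrt h
  refine h2.congr_fderiv ?_
  ext v
  simp
  ring

lemma hasFDerivAt_norm {w : Rd (n + 1)} (h : w ≠ 0) :
    HasFDerivAt (fun w : Rd (n + 1) => ‖w‖) (‖w‖⁻¹ • innerSL ℝ w) w := by
  have := hasFDerivAt_sqrt_norm_sq_add (n := n) 0 (w := w) (by simpa using h)
  simpa [Real.sqrt_sq (norm_nonneg _)] using this

lemma hasFDerivAt_inv_norm_pow {w : Rd (n + 1)} (h : w ≠ 0) :
    HasFDerivAt (fun w : Rd (n + 1) => (‖w‖ ^ n)⁻¹) (-(n * ‖w‖⁻¹ ^ (n + 2)) • innerSL ℝ w) w := by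
  have hw : ‖w‖ ≠ 0 := norm_ne_zero_iff.2 h
  have h1 := (hasDerivAt_inv (pow_ne_zero n hw)).comp_hasFDerivAt w ((hasFDerivAt_norm h).pow n)
  refine h1.congr_fderiv ?_
  ext v
  simp
  rcases n with _ | n
  · simp
  · simp only [Nat.add_sub_cancel]
    field_simp
    ring

lemma integrable_of_continuous_compactSupport {g : Rd (n + 1) → ℝ} (hg : Continuous g)
    (hc : HasCompactSupport g) : Integrable g :=
  hg.integrable_of_hasCompactSupport hc

lemma exists_abs_le {g : Rd (n + 1) → ℝ} (hg : Continuous g) (hc : HasCompactSupport g) :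
    ∃ B, ∀ y, |g y| ≤ B := by
  obtain ⟨B, hB⟩ := hc.exists_bound_of_continuous hg
  exact ⟨B, hB⟩

lemma continuous_fderiv_apply {ψ : Rd (n + 1) → ℝ} (hψ : ContDiff ℝ (⊤ : ℕ∞) ψ) (v : Rd (n + 1)) :
    Continuous (fun x => fderiv ℝ ψ x v) :=
  (hψ.continuous_fderiv (by simp)).clm_apply continuous_const

lemma continuous_potential {D : Rd (n + 1) → ℝ} (hD : Continuous D) (hc : HasCompactSupport D) :
    Continuous (fun z => ∫ y, D y * (‖y - z‖ ^ n)⁻¹) := by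
  have := hc.continuous_convolution_left (ContinuousLinearMap.mul ℝ ℝ) hD
    (locallyIntegrable_inv_norm_pow (n := n) n le_rfl)
  convert this using 2 with z
  simp [convolution, norm_sub_rev]

lemma potential_comp_smul (D : Rd (n + 1) → ℝ) {R : ℝ} (hR : 0 < R) (z : Rd (n + 1)) :
    ∫ y, R⁻¹ * D (R⁻¹ • y) * (‖y - z‖ ^ n)⁻¹ = ∫ y, D y * (‖y - R⁻¹ • z‖ ^ n)⁻¹ := by
  have h := Measure.integral_comp_smul (volume : Measure (Rd (n + 1)))
    (fun y => D y * (‖y - R⁻¹ • z‖ ^ n)⁻¹) R⁻¹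
  rw [finrank_euclideanSpace, Fintype.card_fin, abs_of_pos (by positivity), smul_eq_mul] at h
  have h2 : ∀ y, R⁻¹ * D (R⁻¹ • y) * (‖y - z‖ ^ n)⁻¹ =
      (R ^ (n + 1))⁻¹ * (D (R⁻¹ • y) * (‖R⁻¹ • y - R⁻¹ • z‖ ^ n)⁻¹) := fun y => by
    rw [← smul_sub, norm_smul, Real.norm_of_nonneg (inv_pos.2 hR).le, mul_pow, inv_pow, mul_inv,
      inv_inv, pow_succ, mul_inv]
    field_simp
  simp_rw [h2]
  rw [integral_const_mul, h, inv_pow, inv_inv, ← mul_assoc, inv_mul_cancel₀ (by positivity), one_mul]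

/-- A test function vanishing at the origin with `∫ |y|^{-n} ∂_v ψ ≠ 0`. -/
lemma exists_test_function (hn : 1 ≤ n) : ∃ (ψ : Rd (n + 1) → ℝ) (v : Rd (n + 1)),
    ContDiff ℝ (⊤ : ℕ∞) ψ ∧ HasCompactSupport ψ ∧ ψ 0 = 0 ∧
      ∫ y, fderiv ℝ ψ y v * (‖y‖ ^ n)⁻¹ ≠ 0 := by
  let e : Rd (n + 1) := EuclideanSpace.single 0 1
  have he : ‖e‖ = 1 := by simp [e]
  let ψ : ContDiffBump e := ⟨1 / 4, 1 / 2, by norm_num, by norm_num⟩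
  have hsupp : ∀ y, ψ y ≠ 0 → 1 / 2 ≤ ‖y‖ ∧ 1 / 4 ≤ inner ℝ y e := fun y hy => by
    have hy' : y ∈ ball e (1 / 2) := by
      have : y ∈ Function.support ψ := hy
      rwa [ψ.support_eq] at this
    rw [mem_ball, dist_eq_norm] at hy'
    have h1 := norm_sub_norm_le e y
    rw [norm_sub_rev] at h1
    refine ⟨by linarith, ?_⟩
    have h2 : inner ℝ y e = inner ℝ (y - e) e + 1 := by
      rw [inner_sub_left, real_inner_self_eq_norm_sq, he]; ring
    have h3 := (abs_le.1 (abs_real_inner_le_norm (y - e) e)).1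
    rw [he] at h3
    linarith
  have h0 : ψ (0 : Rd (n + 1)) = 0 := by
    by_contra h
    have := (hsupp 0 h).1
    norm_num at this
  have hts : ∀ y ∈ tsupport ψ, y ≠ 0 := fun y hy => by
    rw [ψ.tsupport_eq, mem_closedBall, dist_eq_norm] at hy
    rintro rfl
    simp [he, ψ] at hy
    norm_num at hy
  have hk : ∀ y, ψ y * fderiv ℝ (fun y : Rd (n + 1) => (‖y‖ ^ n)⁻¹) y e =
      -(n * (ψ y * inner ℝ y e * ‖y‖⁻¹ ^ (n + 2))) := fun y => by
    rcases eq_or_ne y 0 with rfl | hy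
    · simp [h0]
    · rw [(hasFDerivAt_inv_norm_pow hy).fderiv]
      simp [-inner_self_eq_norm_sq_to_K]
      ring
  have hint : Integrable (fun y => ψ y * inner ℝ y e * ‖y‖⁻¹ ^ (n + 2)) := by
    refine ((integrable_of_continuous_compactSupport (ψ.continuous.mul (by fun_prop :
      Continuous fun y : Rd (n + 1) => ‖y‖)) ψ.hasCompactSupport.mul_right).mul_const
        (2 ^ (n + 2))).mono' ?_ (Eventually.of_forall fun y => ?_)
    · exact ((ψ.continuous.measurable.mul (by fun_prop)).mul
        (by fun_prop)).aestronglyMeasurable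
    · by_cases hy : ψ y = 0
      · simp [hy]
      · have h1 := (hsupp y hy).1
        have h2 : ‖y‖⁻¹ ≤ 2 := by
          have := inv_anti₀ (by norm_num) h1; norm_num at this; exact this
        have h3 := abs_real_inner_le_norm y e
        rw [he, mul_one] at h3
        rw [norm_mul, norm_mul, Real.norm_eq_abs, Real.norm_eq_abs, abs_of_nonneg ψ.nonneg,
          norm_pow, norm_inv, norm_norm]
        have := ψ.nonneg (x := y)
        change ψ y * |inner ℝ y e| * ‖y‖⁻¹ ^ (n + 2) ≤ ψ y * ‖y‖ * 2 ^ (n + 2)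
        gcongr
  have hlc := locallyIntegrable_inv_norm_pow (n := n) n le_rfl
  have hψc : ContDiff ℝ (⊤ : ℕ∞) ψ := ψ.contDiff
  refine ⟨ψ, e, hψc, ψ.hasCompactSupport, h0, ?_⟩
  have hparts := integral_mul_fderiv_eq_neg_fderiv_mul_of_integrable (μ := volume)
    (f := ψ) (g := fun y : Rd (n + 1) => (‖y‖ ^ n)⁻¹) (v := e) ?_ ?_ ?_ ?_ ?_
  · rw [← neg_ne_zero, ← hparts]
    simp_rw [hk]
    rw [integral_neg, integral_const_mul, neg_ne_zero]
    refine mul_ne_zero (by positivity) (ne_of_gt ?_)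
    rw [integral_pos_iff_support_of_nonneg _ hint]
    · refine lt_of_lt_of_le (measure_ball_pos volume e (by norm_num : (0 : ℝ) < 1 / 4))
        (measure_mono fun y hy => ?_)
      have hy1 : ψ y ≠ 0 := by
        rw [ψ.one_of_mem_closedBall (ball_subset_closedBall hy)]; norm_num
      have := hsupp y hy1
      have h1 : inner ℝ y e ≠ 0 := by linarith
      have h2 : ‖y‖ ≠ 0 := by linarith
      exact mul_ne_zero (mul_ne_zero hy1 h1) (pow_ne_zero _ (inv_ne_zero h2))
    · intro y
      by_cases hy : ψ y = 0
      · simp [hy]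
      · have := (hsupp y hy).2
        have := ψ.nonneg (x := y)
        exact mul_nonneg (mul_nonneg this (by linarith)) (by positivity)
  · obtain ⟨B, hB⟩ := exists_abs_le (continuous_fderiv_apply hψc e)
      (ψ.hasCompactSupport.fderiv_apply ℝ e)
    have := (integral_abs_mul_inv_norm_sub_pow_le (integrable_of_continuous_compactSupport
      (continuous_fderiv_apply hψc e) (ψ.hasCompactSupport.fderiv_apply ℝ e)) hB 0).1
    simpa using this
  · simp_rw [hk]
    exact (hint.const_mul _).neg
  · obtain ⟨B, hB⟩ := exists_abs_le ψ.continuous ψ.hasCompactSupport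
    have := (integral_abs_mul_inv_norm_sub_pow_le (integrable_of_continuous_compactSupport
      ψ.continuous ψ.hasCompactSupport) hB 0).1
    simpa using this
  · exact fun x _ => hψc.differentiable (by simp) x
  · exact fun x hx => (hasFDerivAt_inv_norm_pow (hts x hx)).differentiableAt

lemma fderiv_comp_inv_smul {ψ : Rd (n + 1) → ℝ} (hψ : ContDiff ℝ (⊤ : ℕ∞) ψ) (R : ℝ)
    (y v : Rd (n + 1)) :
    fderiv ℝ (fun y => ψ (R⁻¹ • y)) y v = R⁻¹ * fderiv ℝ ψ (R⁻¹ • y) v := by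
  have h1 : HasFDerivAt (fun y : Rd (n + 1) => R⁻¹ • y)
    (R⁻¹ • ContinuousLinearMap.id ℝ (Rd (n + 1))) y := (hasFDerivAt_id y).const_smul R⁻¹
  have h2 := ((hψ.differentiable (by simp) (R⁻¹ • y)).hasFDerivAt).comp y h1
  have : (fun y => ψ (R⁻¹ • y)) = ψ ∘ fun y => R⁻¹ • y := rfl
  rw [this, h2.fderiv]
  simp

/-- A function whose Riesz transform is integrable has mean zero. -/
lemma integral_eq_zero_of_hasRieszTransform (hn : 1 ≤ n) {f : Rd (n + 1) → ℝ}
    {F : Rd (n + 1) → Rd (n + 1)} (hf : Integrable f) (hF : HasRieszTransform (n + 1) f F) :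
    ∫ y, f y = 0 := by
  obtain ⟨ψ, v, hψ, hc, h0, hJ⟩ := exists_test_function hn
  set D : Rd (n + 1) → ℝ := fun y => fderiv ℝ ψ y v with hDdef
  have hDcont : Continuous D := continuous_fderiv_apply hψ v
  have hDc : HasCompactSupport D := hc.fderiv_apply ℝ v
  set J : Rd (n + 1) → ℝ := fun z => ∫ y, D y * (‖y - z‖ ^ n)⁻¹ with hJdef
  have hJcont : Continuous J := continuous_potential hDcont hDc
  have hDi := integrable_of_continuous_compactSupport hDcont hDc
  obtain ⟨B, hB⟩ := exists_abs_le hDcont hDc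
  have hJb := fun z => (abs_integral_le_integral_abs).trans
    (integral_abs_mul_inv_norm_sub_pow_le hDi hB z).2
  obtain ⟨P, hP⟩ := exists_abs_le hψ.continuous hc
  let R : ℕ → ℝ := fun k => k + 1
  have hR : ∀ k, 0 < R k := fun k => by positivity
  have hRlim : Tendsto (fun k => (R k)⁻¹) atTop (𝓝 0) :=
    tendsto_inv_atTop_zero.comp (tendsto_natCast_atTop_atTop.atTop_add tendsto_const_nhds)
  have hscale : ∀ z : Rd (n + 1), Tendsto (fun k => (R k)⁻¹ • z) atTop (𝓝 0) := fun z => by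
    simpa using hRlim.smul_const z
  have key : ∀ k, (rieszGamma (n + 1) 1)⁻¹ * ∫ z, f z * J ((R k)⁻¹ • z) =
      -∫ x, ψ ((R k)⁻¹ • x) * inner ℝ (F x) v := fun k => by
    have hs : ContDiff ℝ (⊤ : ℕ∞) (fun y => ψ ((R k)⁻¹ • y)) := hψ.comp (by fun_prop)
    have hsc : HasCompactSupport (fun y => ψ ((R k)⁻¹ • y)) :=
      hc.comp_smul (inv_pos.2 (hR k)).ne'
    rw [← hF.2 _ hs hsc v]
    obtain ⟨B', hB'⟩ := exists_abs_le (continuous_fderiv_apply hs v) (hsc.fderiv_apply ℝ v)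
    rw [(integral_rieszPotential_mul hf (integrable_of_continuous_compactSupport
      (continuous_fderiv_apply hs v) (hsc.fderiv_apply ℝ v)) hB').2]
    congr 2
    ext z
    congr 1
    simp_rw [fderiv_comp_inv_smul hψ]
    exact (potential_comp_smul D (hR k) z).symm
  have lim1 : Tendsto (fun k => ∫ z, f z * J ((R k)⁻¹ • z)) atTop (𝓝 (∫ z, f z * J 0)) := by
    refine tendsto_integral_of_dominated_convergence (fun z => ‖f z‖ *
      (B * (∫ y in ball (0 : Rd (n + 1)) 1, (‖y‖ ^ n)⁻¹) + ∫ y, |D y|))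
      (fun k => hf.aestronglyMeasurable.mul
        (hJcont.comp (by fun_prop : Continuous fun z : Rd (n + 1) => (R k)⁻¹ • z)).aestronglyMeasurable)
      (hf.norm.mul_const _) (fun k => Eventually.of_forall fun z => ?_)
      (Eventually.of_forall fun z => ?_)
    · rw [norm_mul]
      exact mul_le_mul_of_nonneg_left (hJb _) (norm_nonneg _)
    · exact ((hJcont.tendsto 0).comp (hscale z)).const_mul _
  have lim2 : Tendsto (fun k => ∫ x, ψ ((R k)⁻¹ • x) * inner ℝ (F x) v) atTop
      (𝓝 (∫ x, ψ 0 * inner ℝ (F x) v)) := by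
    have hFv : Integrable (fun x => inner ℝ (F x) v) := hF.1.inner_const v
    refine tendsto_integral_of_dominated_convergence (fun x => P * ‖inner ℝ (F x) v‖)
      (fun k => (hψ.continuous.comp (by fun_prop : Continuous fun z : Rd (n + 1) =>
        (R k)⁻¹ • z)).aestronglyMeasurable.mul hFv.aestronglyMeasurable)
      (hFv.norm.const_mul _) (fun k => Eventually.of_forall fun x => ?_)
      (Eventually.of_forall fun x => ?_)
    · rw [norm_mul]
      exact mul_le_mul_of_nonneg_right (hP _) (norm_nonneg _)
    · exact ((hψ.continuous.tendsto 0).comp (hscale x)).mul_const _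
  have h := tendsto_nhds_unique (lim1.const_mul (rieszGamma (n + 1) 1)⁻¹)
    ((lim2.neg).congr fun k => (key k).symm)
  simp only [h0, zero_mul, integral_zero, neg_zero, integral_mul_const] at h
  have hJ0 : J 0 ≠ 0 := by simpa [hJdef] using hJ
  have hγ := (inv_pos.2 (rieszGamma_one_pos hn)).ne'
  simpa [hJ0, hγ] using h

/-- The smooth truncation of the `j`-th component of the unit field `w / |w|`. -/
noncomputable def truncField (η : Rd (n + 1) → ℝ) (j : Fin (n + 1)) (s : ℝ) (w : Rd (n + 1)) : ℝ :=
  η (s • w) * (w j * (√(‖w‖ ^ 2 + s))⁻¹)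

/-- The derivative of `truncField` in the direction of the `j`-th axis. -/
noncomputable def truncFieldDeriv (η : Rd (n + 1) → ℝ) (j : Fin (n + 1)) (s : ℝ)
    (w : Rd (n + 1)) : ℝ :=
  s * fderiv ℝ η (s • w) (EuclideanSpace.single j 1) * (w j * (√(‖w‖ ^ 2 + s))⁻¹) +
    η (s • w) * ((√(‖w‖ ^ 2 + s))⁻¹ - w j ^ 2 * (√(‖w‖ ^ 2 + s))⁻¹ ^ 3)

lemma contDiff_truncField {η : Rd (n + 1) → ℝ} (hη : ContDiff ℝ (⊤ : ℕ∞) η) (j : Fin (n + 1))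
    {s : ℝ} (hs : 0 < s) : ContDiff ℝ (⊤ : ℕ∞) (truncField η j s) := by
  have hpos : ∀ w : Rd (n + 1), 0 < ‖w‖ ^ 2 + s := fun w => by positivity
  refine (hη.comp (by fun_prop)).mul (ContDiff.mul (by fun_prop) (ContDiff.inv ?_ ?_))
  · exact ((contDiff_norm_sq ℝ).add contDiff_const).sqrt fun w => (hpos w).ne'
  · exact fun w => (Real.sqrt_pos.2 (hpos w)).ne'

lemma fderiv_truncField {η : Rd (n + 1) → ℝ} (hη : ContDiff ℝ (⊤ : ℕ∞) η) (j : Fin (n + 1))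
    {s : ℝ} (hs : 0 < s) (w : Rd (n + 1)) :
    fderiv ℝ (truncField η j s) w (EuclideanSpace.single j 1) = truncFieldDeriv η j s w := by
  have hpos : 0 < ‖w‖ ^ 2 + s := by positivity
  have hq := Real.sqrt_pos.2 hpos
  have h1 : HasFDerivAt (fun w => η (s • w)) _ w :=
    ((hη.differentiable (by simp) (s • w)).hasFDerivAt).comp w ((hasFDerivAt_id w).const_smul s)
  have h2 : HasFDerivAt (fun w : Rd (n + 1) => w j) (EuclideanSpace.proj j : Rd (n + 1) →L[ℝ] ℝ) w :=
    (EuclideanSpace.proj j : Rd (n + 1) →L[ℝ] ℝ).hasFDerivAt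
  have h3 := (hasDerivAt_inv hq.ne').comp_hasFDerivAt w
    (hasFDerivAt_sqrt_norm_sq_add s hpos.ne')
  have h4 := h1.mul (h2.mul h3)
  have : truncField η j s = (fun w => η (s • w)) *
    ((fun w : Rd (n + 1) => w j) * ((fun y : ℝ => y⁻¹) ∘ fun w => √(‖w‖ ^ 2 + s))) := rfl
  rw [this, h4.fderiv]
  simp [truncFieldDeriv, EuclideanSpace.inner_single_right]
  field_simp
  ring

lemma abs_truncFieldDeriv_le {η : Rd (n + 1) → ℝ} {M : ℝ} (hη1 : ∀ w, |η w| ≤ 1)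
    (hM : ∀ w, ‖w‖ * ‖fderiv ℝ η w‖ ≤ M) (j : Fin (n + 1)) {s : ℝ} (hs : 0 < s) {w : Rd (n + 1)}
    (hw : w ≠ 0) : |truncFieldDeriv η j s w| ≤ (M + 1) * ‖w‖⁻¹ := by
  have hw' : 0 < ‖w‖ := norm_pos_iff.2 hw
  have hpos : 0 < ‖w‖ ^ 2 + s := by positivity
  have hS := Real.sqrt_pos.2 hpos
  set q := (√(‖w‖ ^ 2 + s))⁻¹ with hqdef
  have hq : 0 < q := inv_pos.2 hS
  have hwS : ‖w‖ ≤ √(‖w‖ ^ 2 + s) := Real.le_sqrt_of_sq_le (by linarith)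
  have hqw : q ≤ ‖w‖⁻¹ := inv_anti₀ hw' hwS
  have hwq : ‖w‖ * q ≤ 1 := by
    calc ‖w‖ * q ≤ ‖w‖ * ‖w‖⁻¹ := by gcongr
      _ = 1 := by field_simp
  have hj := abs_apply_le_norm w j
  have hjq : |w j * q| ≤ 1 := by
    rw [abs_mul, abs_of_pos hq]
    exact (mul_le_mul_of_nonneg_right hj hq.le).trans hwq
  have hd : |fderiv ℝ η (s • w) (EuclideanSpace.single j 1)| ≤ ‖fderiv ℝ η (s • w)‖ := by
    simpa using (fderiv ℝ η (s • w)).le_opNorm (EuclideanSpace.single j 1)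
  have h1 : |s * fderiv ℝ η (s • w) (EuclideanSpace.single j 1) * (w j * q)| ≤ M * ‖w‖⁻¹ := by
    rw [abs_mul, abs_mul, abs_of_pos hs]
    have h2 := hM (s • w)
    rw [norm_smul, Real.norm_of_nonneg hs.le] at h2
    calc _ ≤ s * ‖fderiv ℝ η (s • w)‖ * 1 := by gcongr
      _ = s * ‖w‖ * ‖fderiv ℝ η (s • w)‖ * ‖w‖⁻¹ := by field_simp
      _ ≤ M * ‖w‖⁻¹ := by gcongr
  have h2 : |η (s • w) * (q - w j ^ 2 * q ^ 3)| ≤ ‖w‖⁻¹ := by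
    rw [abs_mul]
    have h3 : w j ^ 2 * q ^ 3 ≤ q := by
      have : (w j * q) ^ 2 ≤ 1 := by rw [sq_le_one_iff_abs_le_one]; exact hjq
      calc w j ^ 2 * q ^ 3 = (w j * q) ^ 2 * q := by ring
        _ ≤ 1 * q := by gcongr
        _ = q := one_mul q
    have h4 : 0 ≤ w j ^ 2 * q ^ 3 := by positivity
    rw [abs_of_nonneg (by linarith : 0 ≤ q - w j ^ 2 * q ^ 3)]
    calc _ ≤ 1 * (q - w j ^ 2 * q ^ 3) := by
          gcongr
          exact hη1 _
      _ ≤ ‖w‖⁻¹ := by linarith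
  unfold truncFieldDeriv
  refine (abs_add_le _ _).trans ?_
  rw [add_mul, one_mul]
  exact add_le_add h1 h2

lemma tendsto_truncFieldDeriv {η : Rd (n + 1) → ℝ} (hη : ContDiff ℝ (⊤ : ℕ∞) η) (h0 : η 0 = 1)
    (j : Fin (n + 1)) {s : ℕ → ℝ} (hs : Tendsto s atTop (𝓝 0)) {w : Rd (n + 1)} (hw : w ≠ 0) :
    Tendsto (fun k => truncFieldDeriv η j (s k) w) atTop (𝓝 (unitFieldDeriv n j w)) := by
  have hw' : 0 < ‖w‖ := norm_pos_iff.2 hw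
  have c1 : Continuous fun s : ℝ => η (s • w) := hη.continuous.comp (by fun_prop)
  have c2 : Continuous fun s : ℝ => fderiv ℝ η (s • w) (EuclideanSpace.single j 1) :=
    (continuous_fderiv_apply hη _).comp (by fun_prop)
  have c3 : ContinuousAt (fun s : ℝ => (√(‖w‖ ^ 2 + s))⁻¹) 0 := by
    refine ContinuousAt.inv₀ (by fun_prop) ?_
    rw [add_zero, Real.sqrt_sq hw'.le]
    exact hw'.ne'
  have hc : ContinuousAt (fun s : ℝ => truncFieldDeriv η j s w) 0 := by
    unfold truncFieldDeriv
    exact (((continuousAt_id.mul c2.continuousAt).mul (continuousAt_const.mul c3)).add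
      (c1.continuousAt.mul (c3.sub (continuousAt_const.mul (c3.pow 3)))))
  have := hc.tendsto.comp hs
  refine this.trans_eq ?_
  simp [truncFieldDeriv, unitFieldDeriv, h0, Real.sqrt_sq hw'.le]

lemma tendsto_truncField {η : Rd (n + 1) → ℝ} (hη : Continuous η) (h0 : η 0 = 1)
    (j : Fin (n + 1)) {s : ℕ → ℝ} (hs : Tendsto s atTop (𝓝 0)) {w : Rd (n + 1)} (hw : w ≠ 0) :
    Tendsto (fun k => truncField η j (s k) w) atTop (𝓝 (unitField (n + 1) w j)) := by
  have hw' : 0 < ‖w‖ := norm_pos_iff.2 hw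
  have c1 : Continuous fun s : ℝ => η (s • w) := hη.comp (by fun_prop)
  have c3 : ContinuousAt (fun s : ℝ => (√(‖w‖ ^ 2 + s))⁻¹) 0 := by
    refine ContinuousAt.inv₀ (by fun_prop) ?_
    rw [add_zero, Real.sqrt_sq hw'.le]
    exact hw'.ne'
  have hc : ContinuousAt (fun s : ℝ => truncField η j s w) 0 :=
    c1.continuousAt.mul (continuousAt_const.mul c3)
  have := hc.tendsto.comp hs
  refine this.trans_eq ?_
  simp [truncField, unitField, h0, Real.sqrt_sq hw'.le, mul_comm]

lemma abs_truncField_le {η : Rd (n + 1) → ℝ} (hη1 : ∀ w, |η w| ≤ 1) (j : Fin (n + 1)) {s : ℝ}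
    (hs : 0 < s) (w : Rd (n + 1)) : |truncField η j s w| ≤ 1 := by
  have hpos : 0 < ‖w‖ ^ 2 + s := by positivity
  have hS := Real.sqrt_pos.2 hpos
  have hwS : |w j| ≤ √(‖w‖ ^ 2 + s) :=
    (abs_apply_le_norm w j).trans (Real.le_sqrt_of_sq_le (by linarith))
  have : |w j * (√(‖w‖ ^ 2 + s))⁻¹| ≤ 1 := by
    rw [abs_mul, abs_of_pos (inv_pos.2 hS), ← div_eq_mul_inv]
    exact (div_le_one hS).2 hwS
  unfold truncField
  rw [abs_mul]
  exact mul_le_one₀ (hη1 _) (abs_nonneg _) this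

/-- Integration by parts of the weak gradient of `I_1 f` against the unit field. -/
lemma integral_rieszPotential_mul_unitFieldDeriv {f : Rd (n + 1) → ℝ}
    {F : Rd (n + 1) → Rd (n + 1)} (hF : HasRieszTransform (n + 1) f F) {x : Rd (n + 1)}
    (hx : Integrable (fun y => rieszPotential (n + 1) 1 f y * ‖y - x‖⁻¹)) (j : Fin (n + 1)) :
    ∫ y, rieszPotential (n + 1) 1 f y * unitFieldDeriv n j (y - x) =
      -∫ y, unitField (n + 1) (y - x) j * F y j := by
  let b : ContDiffBump (0 : Rd (n + 1)) := ⟨1, 2, by norm_num, by norm_num⟩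
  let η : Rd (n + 1) → ℝ := b
  have hη : ContDiff ℝ (⊤ : ℕ∞) η := b.contDiff
  have hηc : HasCompactSupport η := b.hasCompactSupport
  have h0 : η 0 = 1 := b.one_of_mem_closedBall (by simp [b])
  have hη1 : ∀ w, |η w| ≤ 1 := fun w => abs_le.2 ⟨by linarith [b.nonneg (x := w)], b.le_one⟩
  obtain ⟨M, hM⟩ : ∃ M, ∀ w, ‖w‖ * ‖fderiv ℝ η w‖ ≤ M := by
    have hcont : Continuous fun w => ‖w‖ * ‖fderiv ℝ η w‖ :=
      continuous_norm.mul (hη.continuous_fderiv (by simp)).norm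
    obtain ⟨M, hM⟩ := exists_abs_le hcont ((hηc.fderiv ℝ).norm.mul_left)
    exact ⟨M, fun w => (le_abs_self _).trans (hM w)⟩
  let u := rieszPotential (n + 1) 1 f
  let s : ℕ → ℝ := fun k => ((k : ℝ) + 1)⁻¹
  have hs : ∀ k, 0 < s k := fun k => by positivity
  have hslim : Tendsto s atTop (𝓝 0) :=
    tendsto_inv_atTop_zero.comp (tendsto_natCast_atTop_atTop.atTop_add tendsto_const_nhds)
  have humeas : AEStronglyMeasurable u := by
    have : AEStronglyMeasurable (fun y => u y * ‖y - x‖⁻¹ * ‖y - x‖) :=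
      hx.aestronglyMeasurable.mul (by fun_prop : Continuous fun y : Rd (n + 1) =>
        ‖y - x‖).aestronglyMeasurable
    refine this.congr ?_
    filter_upwards [ae_ne_point x] with y hy
    have := norm_ne_zero_iff.2 (sub_ne_zero.2 hy)
    field_simp
  let e : Rd (n + 1) := EuclideanSpace.single j 1
  have hFj : Integrable (fun y => F y j) := by
    refine (hF.1.inner_const e).congr (Eventually.of_forall fun y => ?_)
    simp [e, EuclideanSpace.inner_single_right]
  have key : ∀ k, ∫ y, u y * truncFieldDeriv η j (s k) (y - x) =
      -∫ y, truncField η j (s k) (y - x) * F y j := fun k => by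
    have hT := contDiff_truncField hη j (hs k)
    have hTc : HasCompactSupport (truncField η j (s k)) :=
      (hηc.comp_smul (hs k).ne').mul_right
    have h := hF.2 (fun y => truncField η j (s k) (y - x)) (hT.comp (by fun_prop))
      (hTc.comp_homeomorph (Homeomorph.subRight x)) e
    simp only [fderiv_comp_sub] at h
    simp only [e, fderiv_truncField hη j (hs k)] at h
    simpa [EuclideanSpace.inner_single_right] using h
  have lim1 : Tendsto (fun k => ∫ y, u y * truncFieldDeriv η j (s k) (y - x)) atTop
      (𝓝 (∫ y, u y * unitFieldDeriv n j (y - x))) := by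
    refine tendsto_integral_of_dominated_convergence (fun y => (M + 1) * ‖u y * ‖y - x‖⁻¹‖)
      (fun k => ?_) (hx.norm.const_mul _) (fun k => ?_) ?_
    · have := continuous_fderiv_apply (contDiff_truncField hη j (hs k)) e
      simp only [e, fderiv_truncField hη j (hs k)] at this
      exact humeas.mul (this.comp (by fun_prop : Continuous fun y : Rd (n + 1) =>
        y - x)).aestronglyMeasurable
    · filter_upwards [ae_ne_point x] with y hy
      have := abs_truncFieldDeriv_le hη1 hM j (hs k) (sub_ne_zero.2 hy)
      rw [norm_mul, norm_mul, norm_inv, norm_norm]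
      calc _ ≤ ‖u y‖ * ((M + 1) * ‖y - x‖⁻¹) := by gcongr; exact this
        _ = _ := by ring
    · filter_upwards [ae_ne_point x] with y hy
      exact (tendsto_truncFieldDeriv hη h0 j hslim (sub_ne_zero.2 hy)).const_mul _
  have lim2 : Tendsto (fun k => ∫ y, truncField η j (s k) (y - x) * F y j) atTop
      (𝓝 (∫ y, unitField (n + 1) (y - x) j * F y j)) := by
    refine tendsto_integral_of_dominated_convergence (fun y => ‖F y j‖)
      (fun k => ?_) hFj.norm (fun k => Eventually.of_forall fun y => ?_) ?_
    · exact ((contDiff_truncField hη j (hs k)).continuous.comp (by fun_prop :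
        Continuous fun y : Rd (n + 1) => y - x)).aestronglyMeasurable.mul hFj.aestronglyMeasurable
    · rw [norm_mul]
      exact mul_le_of_le_one_left (norm_nonneg _) (abs_truncField_le hη1 j (hs k) _)
    · filter_upwards [ae_ne_point x] with y hy
      exact (tendsto_truncField hη.continuous h0 j hslim (sub_ne_zero.2 hy)).mul_const _
  exact tendsto_nhds_unique (lim1.congr key) lim2.neg

lemma abs_unitField_apply_le (y : Rd (n + 1)) (j : Fin (n + 1)) : |unitField (n + 1) y j| ≤ 1 := by
  have h := abs_apply_le_norm (unitField (n + 1) y) j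
  refine h.trans ?_
  rw [unitField, norm_smul, norm_inv, norm_norm]
  exact inv_mul_le_one

lemma unitField_neg (y : Rd (n + 1)) : unitField (n + 1) (-y) = -unitField (n + 1) y := by
  simp [unitField]

lemma measurable_unitField_apply (j : Fin (n + 1)) :
    Measurable (fun y : Rd (n + 1) => unitField (n + 1) y j) := by
  simp only [unitField, PiLp.smul_apply]
  fun_prop

/-- The representation formula for the logarithmic potential. -/
lemma logPotential_representation (hn : 1 ≤ n) {f : Rd (n + 1) → ℝ} {F : Rd (n + 1) → Rd (n + 1)}
    (hf : Integrable f) (hF : HasRieszTransform (n + 1) f F) {x : Rd (n + 1)}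
    (hx : Integrable (fun y => Real.log (1 / ‖x - y‖) * f y)) :
    Integrable (fun y => rieszPotential (n + 1) 1 f y / ‖x - y‖) ∧
    logPotential (n + 1) f x =
      rieszPotential (n + 1) (((n + 1 : ℕ) : ℝ) - 1) (rieszPotential (n + 1) 1 f) x ∧
    logPotential (n + 1) f x =
      1 / ((((n + 1 : ℕ) : ℝ) - 1) * rieszGamma (n + 1) (((n + 1 : ℕ) : ℝ) - 1)) *
        ∫ y, inner ℝ (F y) (unitField (n + 1) (x - y)) := by
  have h0 := integral_eq_zero_of_hasRieszTransform hn hf hF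
  obtain ⟨hi, -, hI⟩ := riesz_fubini hn isHomKernel_inv_norm hf h0 hx
  have e1 : (((n + 1 : ℕ) : ℝ) - 1) = n := by push_cast; ring
  have hn0 : (0 : ℝ) < n := by exact_mod_cast hn
  have hγ1 := rieszGamma_one_pos hn
  have hγn := rieszGamma_last_pos hn
  have hκ := logGamma_pos (n := n)
  have hσ := sphereArea_pos (n := n)
  have hγκ := rieszGamma_one_mul_last hn
  have hlogint : ∫ z, f z * logKernel (fun y : Rd (n + 1) => ‖y‖⁻¹) (z - x) =
      sphereArea n * ∫ z, Real.log (1 / ‖x - z‖) * f z := by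
    have : ∀ᵐ z, f z * logKernel (fun y : Rd (n + 1) => ‖y‖⁻¹) (z - x) =
        kernelConst n * f z + sphereArea n * (Real.log (1 / ‖x - z‖) * f z) := by
      filter_upwards [ae_ne_point x] with z hz
      rw [logKernel_inv_norm hn (sub_ne_zero.2 hz), one_div, Real.log_inv, norm_sub_rev]
      ring
    rw [integral_congr_ae this, integral_add (hf.const_mul _) (hx.const_mul _),
      integral_const_mul, integral_const_mul, h0]
    ring
  have hlog : logPotential (n + 1) f x = (rieszGamma (n + 1) n)⁻¹ *
      ∫ y, rieszPotential (n + 1) 1 f y * ‖y - x‖⁻¹ := by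
    rw [hI, hlogint, logPotential]
    have : (logGamma (n + 1))⁻¹ =
        (rieszGamma (n + 1) n)⁻¹ * ((rieszGamma (n + 1) 1)⁻¹ * sphereArea n) := by
      field_simp
      linarith
    rw [one_div, this]
    ring
  refine ⟨?_, ?_, ?_⟩
  · simpa only [norm_sub_rev x, div_eq_mul_inv] using hi
  · rw [hlog, rieszPotential_last]
    simp only [norm_sub_rev x]
  · rw [hlog, e1]
    have hparts := fun j => integral_rieszPotential_mul_unitFieldDeriv hF hi j
    have hFj : ∀ j, Integrable (fun y => unitField (n + 1) (y - x) j * F y j) := fun j => by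
      have hFj : Integrable (fun y => F y j) := by
        refine (hF.1.inner_const (EuclideanSpace.single j (1 : ℝ))).congr
          (Eventually.of_forall fun y => ?_)
        simp [EuclideanSpace.inner_single_right]
      exact hFj.bdd_mul ((measurable_unitField_apply j).comp
        (by fun_prop : Measurable fun y : Rd (n + 1) => y - x)).aestronglyMeasurable
        (Eventually.of_forall fun y => abs_unitField_apply_le _ j)
    have hmj : ∀ j, Integrable (fun y => rieszPotential (n + 1) 1 f y * unitFieldDeriv n j (y - x)) :=
      fun j => (riesz_fubini hn (isHomKernel_unitFieldDeriv j) hf h0 hx).1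
    have hsum : n * ∫ y, rieszPotential (n + 1) 1 f y * ‖y - x‖⁻¹ =
        ∫ y, inner ℝ (F y) (unitField (n + 1) (x - y)) := by
      have l : ∑ j, ∫ y, rieszPotential (n + 1) 1 f y * unitFieldDeriv n j (y - x) =
          n * ∫ y, rieszPotential (n + 1) 1 f y * ‖y - x‖⁻¹ := by
        rw [← integral_finsetSum _ fun j _ => hmj j, ← integral_const_mul]
        congr 1
        ext y
        rw [← Finset.mul_sum, sum_unitFieldDeriv]
        ring
      rw [← l, Finset.sum_congr rfl fun j _ => hparts j, Finset.sum_neg_distrib,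
        ← integral_finsetSum _ fun j _ => hFj j, ← integral_neg]
      congr 1
      ext y
      rw [← neg_sub y x, unitField_neg, inner_neg_right, PiLp.inner_apply]
      simp
    rw [← hsum]
    field_simp

lemma integral_mul_fderiv_eq_neg_of_compactSupport {a ψ : Rd (n + 1) → ℝ}
    (ha : ContDiff ℝ (⊤ : ℕ∞) a) (hψ : ContDiff ℝ (⊤ : ℕ∞) ψ) (hc : HasCompactSupport ψ)
    (v : Rd (n + 1)) :
    ∫ x, a x * fderiv ℝ ψ x v = -∫ x, fderiv ℝ a x v * ψ x := by
  refine integral_mul_fderiv_eq_neg_fderiv_mul_of_integrable ?_ ?_ ?_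
    (fun x _ => ha.differentiable (by simp) x) (fun x _ => hψ.differentiable (by simp) x)
  · exact integrable_of_continuous_compactSupport
      ((continuous_fderiv_apply ha v).mul hψ.continuous) hc.mul_left
  · exact integrable_of_continuous_compactSupport
      (ha.continuous.mul (continuous_fderiv_apply hψ v)) (hc.fderiv_apply ℝ v).mul_left
  · exact integrable_of_continuous_compactSupport (ha.continuous.mul hψ.continuous) hc.mul_left

lemma rieszPotential_eq_convolution (φ : Rd (n + 1) → ℝ) :
    rieszPotential (n + 1) 1 φ = fun x => (rieszGamma (n + 1) 1)⁻¹ *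
      convolution φ (fun y : Rd (n + 1) => (‖y‖ ^ n)⁻¹) (ContinuousLinearMap.mul ℝ ℝ) volume x := by
  ext x
  rw [rieszPotential_one]
  rfl

lemma contDiff_rieszPotential {φ : Rd (n + 1) → ℝ} (hφ : ContDiff ℝ (⊤ : ℕ∞) φ)
    (hc : HasCompactSupport φ) : ContDiff ℝ (⊤ : ℕ∞) (rieszPotential (n + 1) 1 φ) := by
  rw [rieszPotential_eq_convolution]
  exact contDiff_const.mul (hc.contDiff_convolution_left _ hφ
    (locallyIntegrable_inv_norm_pow (n := n) n le_rfl))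

lemma fderiv_rieszPotential {φ : Rd (n + 1) → ℝ} (hφ : ContDiff ℝ (⊤ : ℕ∞) φ)
    (hc : HasCompactSupport φ) (x v : Rd (n + 1)) :
    fderiv ℝ (rieszPotential (n + 1) 1 φ) x v =
      (rieszGamma (n + 1) 1)⁻¹ * ∫ y, fderiv ℝ φ y v * (‖x - y‖ ^ n)⁻¹ := by
  have hk := locallyIntegrable_inv_norm_pow (n := n) n le_rfl
  have h := (hc.hasFDerivAt_convolution_left (ContinuousLinearMap.mul ℝ ℝ)
    (hφ.of_le (by simp)) hk x).const_mul (rieszGamma (n + 1) 1)⁻¹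
  rw [rieszPotential_eq_convolution, h.fderiv, smul_apply, smul_eq_mul,
    convolution_def, ContinuousLinearMap.integral_apply]
  · rfl
  · exact (hc.fderiv ℝ).convolutionExists_left _ (hφ.continuous_fderiv (by simp)) hk x

lemma rieszTransform_apply (φ : Rd (n + 1) → ℝ) (x : Rd (n + 1)) (j : Fin (n + 1)) :
    rieszTransform (n + 1) φ x j =
      fderiv ℝ (rieszPotential (n + 1) 1 φ) x (EuclideanSpace.single j 1) := by
  have : inner ℝ (rieszTransform (n + 1) φ x) (EuclideanSpace.single j (1 : ℝ)) =
      fderiv ℝ (rieszPotential (n + 1) 1 φ) x (EuclideanSpace.single j 1) := by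
    rw [rieszTransform, gradient, InnerProductSpace.toDual_symm_apply]
  rw [← this]
  simp [EuclideanSpace.inner_single_right]

lemma hasRieszTransform_rieszTransform {φ : Rd (n + 1) → ℝ} (hφ : ContDiff ℝ (⊤ : ℕ∞) φ)
    (hc : HasCompactSupport φ) (hi : Integrable (rieszTransform (n + 1) φ)) :
    HasRieszTransform (n + 1) φ (rieszTransform (n + 1) φ) := by
  refine ⟨hi, fun ψ hψ hψc v => ?_⟩
  rw [integral_mul_fderiv_eq_neg_of_compactSupport (contDiff_rieszPotential hφ hc) hψ hψc]
  congr 2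
  ext x
  rw [rieszTransform, gradient, InnerProductSpace.toDual_symm_apply, mul_comm]

lemma exists_abs_inv_pow_taylor_le (n : ℕ) : ∃ C : ℝ, 0 ≤ C ∧ ∀ q : ℝ, 1 / 2 ≤ q →
    |(q ^ n)⁻¹ - 1 + n / 2 * (q ^ 2 - 1)| ≤ C * (q - 1) ^ 2 := by
  induction n with
  | zero => exact ⟨0, le_rfl, fun q _ => by simp⟩
  | succ n ih =>
    obtain ⟨C, hC, h⟩ := ih
    refine ⟨C + (2 * (n * 2 ^ n) + 5 / 2), by positivity, fun q hq => ?_⟩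
    have hq0 : 0 < q := by linarith
    have hp : q⁻¹ ≤ 2 := by
      have := inv_anti₀ (by norm_num) hq; norm_num at this; exact this
    have hp0 := inv_pos.2 hq0
    have e : (q ^ (n + 1))⁻¹ - 1 + ((n + 1 : ℕ) : ℝ) / 2 * (q ^ 2 - 1) =
        ((q ^ n)⁻¹ - 1 + n / 2 * (q ^ 2 - 1)) + ((q ^ n)⁻¹ - 1) * (1 - q) * q⁻¹ +
          (q - 1) ^ 2 * (1 / 2 + q⁻¹) := by
      push_cast
      field_simp
      ring
    have h1 : |(q ^ n)⁻¹ - 1| ≤ n * 2 ^ n * |q - 1| := by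
      simpa using abs_inv_pow_sub_le (n := n) (a := q) (b := 1) one_pos hq
    have h2 : |((q ^ n)⁻¹ - 1) * (1 - q) * q⁻¹| ≤ 2 * (n * 2 ^ n) * (q - 1) ^ 2 := by
      rw [abs_mul, abs_mul, abs_of_pos hp0, abs_sub_comm 1 q]
      calc _ ≤ (n * 2 ^ n * |q - 1|) * |q - 1| * 2 := by gcongr
        _ = 2 * (n * 2 ^ n) * |q - 1| ^ 2 := by ring
        _ = _ := by rw [sq_abs]
    have h3 : |(q - 1) ^ 2 * (1 / 2 + q⁻¹)| ≤ 5 / 2 * (q - 1) ^ 2 := by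
      rw [abs_of_nonneg (by positivity)]
      nlinarith [sq_nonneg (q - 1)]
    rw [e]
    refine (abs_add_three _ _ _).trans ?_
    rw [add_mul, add_mul]
    linarith [h q hq]

lemma exists_abs_kernel_taylor_le (n : ℕ) : ∃ C : ℝ, 0 ≤ C ∧ ∀ x y : Rd (n + 1), x ≠ 0 →
    2 * ‖y‖ ≤ ‖x‖ →
    |(‖x - y‖ ^ n)⁻¹ - (‖x‖ ^ n)⁻¹ - n * ‖x‖⁻¹ ^ (n + 2) * inner ℝ x y| ≤
      C * ‖y‖ ^ 2 * ‖x‖⁻¹ ^ (n + 2) := by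
  obtain ⟨C, hC, h⟩ := exists_abs_inv_pow_taylor_le n
  refine ⟨C + n / 2, by positivity, fun x y hx hxy => ?_⟩
  have hx' : 0 < ‖x‖ := norm_pos_iff.2 hx
  set q := ‖x - y‖ / ‖x‖ with hq
  have hdiff : |‖x - y‖ - ‖x‖| ≤ ‖y‖ := by
    have := abs_norm_sub_norm_le (x - y) x
    simpa using this
  have hq1 : 1 / 2 ≤ q := by
    rw [hq, le_div_iff₀ hx']
    linarith [(abs_le.1 hdiff).1]
  have hq2 : (q - 1) ^ 2 ≤ ‖y‖ ^ 2 * ‖x‖⁻¹ ^ 2 := by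
    have : q - 1 = (‖x - y‖ - ‖x‖) * ‖x‖⁻¹ := by rw [hq]; field_simp
    rw [this, mul_pow]
    exact mul_le_mul_of_nonneg_right (sq_le_sq' (abs_le.1 hdiff).1 (abs_le.1 hdiff).2)
      (by positivity)
  have hqq : q ^ 2 - 1 = (‖y‖ ^ 2 - 2 * inner ℝ x y) * ‖x‖⁻¹ ^ 2 := by
    rw [hq, div_pow, norm_sub_sq_real]
    field_simp
    ring
  have hn' : (‖x - y‖ ^ n)⁻¹ = (q ^ n)⁻¹ * ‖x‖⁻¹ ^ n := by
    rw [hq, div_pow, inv_pow, inv_div]; field_simp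
  have e : (‖x - y‖ ^ n)⁻¹ - (‖x‖ ^ n)⁻¹ - n * ‖x‖⁻¹ ^ (n + 2) * inner ℝ x y =
      ((q ^ n)⁻¹ - 1 + n / 2 * (q ^ 2 - 1)) * ‖x‖⁻¹ ^ n - n / 2 * ‖y‖ ^ 2 * ‖x‖⁻¹ ^ (n + 2) := by
    rw [hn', hqq, inv_pow]
    ring
  rw [e]
  have h1 := h q hq1
  refine (abs_sub _ _).trans ?_
  rw [abs_mul, abs_of_nonneg (by positivity : 0 ≤ ‖x‖⁻¹ ^ n),
    abs_of_nonneg (by positivity : 0 ≤ n / 2 * ‖y‖ ^ 2 * ‖x‖⁻¹ ^ (n + 2))]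
  calc _ ≤ C * (‖y‖ ^ 2 * ‖x‖⁻¹ ^ 2) * ‖x‖⁻¹ ^ n + n / 2 * ‖y‖ ^ 2 * ‖x‖⁻¹ ^ (n + 2) := by
        gcongr
        exact h1.trans (by gcongr)
    _ = _ := by ring

lemma integrable_of_decay {g : Rd (n + 1) → ℝ} (hg : Continuous g) {R C : ℝ} (hR : 1 ≤ R)
    (hC : 0 ≤ C) (h : ∀ x, R ≤ ‖x‖ → |g x| ≤ C * ‖x‖⁻¹ ^ (n + 2)) : Integrable g := by
  obtain ⟨B, hB⟩ := (isCompact_closedBall (0 : Rd (n + 1)) R).exists_bound_of_continuousOn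
    hg.continuousOn
  have hi : Integrable ((closedBall (0 : Rd (n + 1)) R).indicator fun _ => B) :=
    (integrable_indicator_iff measurableSet_closedBall).2
      (integrableOn_const (measure_closedBall_lt_top.ne))
  refine (hi.add ((integrable_one_add_norm_pow (n := n)).const_mul (C * 2 ^ (n + 2)))).mono'
    hg.aestronglyMeasurable (Eventually.of_forall fun x => ?_)
  simp only [Pi.add_apply]
  rcases le_or_gt ‖x‖ R with hx | hx
  · have hm : x ∈ closedBall (0 : Rd (n + 1)) R := by simpa using hx
    rw [indicator_of_mem hm]
    have : 0 ≤ C * 2 ^ (n + 2) * (1 + ‖x‖)⁻¹ ^ (n + 2) := by positivity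
    linarith [hB x hm]
  · have hm : x ∉ closedBall (0 : Rd (n + 1)) R := by simpa using hx
    rw [indicator_of_notMem hm, zero_add]
    have hx0 : 0 < ‖x‖ := by linarith
    have h5 : ‖x‖⁻¹ ≤ 2 * (1 + ‖x‖)⁻¹ := by
      rw [← div_eq_mul_inv, inv_eq_one_div, div_le_div_iff₀ hx0 (by linarith)]; linarith
    calc _ ≤ C * ‖x‖⁻¹ ^ (n + 2) := h x hx.le
      _ ≤ C * (2 * (1 + ‖x‖)⁻¹) ^ (n + 2) := by gcongr
      _ = _ := by rw [mul_pow]; ring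

/-- The Riesz transform of a test function of mean zero is integrable. -/
lemma integrable_rieszTransform_apply (hn : 1 ≤ n) {φ : Rd (n + 1) → ℝ}
    (hφ : ContDiff ℝ (⊤ : ℕ∞) φ) (hc : HasCompactSupport φ) (h0 : ∫ x, φ x = 0)
    (j : Fin (n + 1)) : Integrable (fun x => rieszTransform (n + 1) φ x j) := by
  simp_rw [rieszTransform_apply]
  set e : Rd (n + 1) := EuclideanSpace.single j 1
  set D : Rd (n + 1) → ℝ := fun y => fderiv ℝ φ y e
  have hDc : Continuous D := continuous_fderiv_apply hφ e
  have hDs : HasCompactSupport D := hc.fderiv_apply ℝ e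
  have hDi := integrable_of_continuous_compactSupport hDc hDs
  obtain ⟨B, hB⟩ := exists_abs_le hDc hDs
  have hD0 : ∫ y, D y = 0 := by
    simpa using integral_mul_fderiv_eq_neg_of_compactSupport
      (contDiff_const (c := (1 : ℝ))) hφ hc e
  have hD1i : ∀ x : Rd (n + 1), Integrable (fun y => inner ℝ x y * D y) := fun x =>
    integrable_of_continuous_compactSupport ((by fun_prop : Continuous fun y : Rd (n + 1) =>
      inner ℝ x y).mul hDc) hDs.mul_left
  have hD1 : ∀ x : Rd (n + 1), ∫ y, inner ℝ x y * D y = 0 := fun x => by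
    have h := integral_mul_fderiv_eq_neg_of_compactSupport
      (a := fun y : Rd (n + 1) => innerSL ℝ x y) (innerSL ℝ x).contDiff hφ hc e
    simp only [ContinuousLinearMap.fderiv, integral_const_mul, h0, mul_zero, neg_zero] at h
    exact h
  obtain ⟨R, hR, hsupp⟩ : ∃ R : ℝ, 1 ≤ R ∧ ∀ y, D y ≠ 0 → ‖y‖ ≤ R := by
    obtain ⟨R, hR⟩ := hDs.isBounded.exists_norm_le
    exact ⟨max 1 R, le_max_left _ _, fun y hy =>
      (hR y (subset_tsupport _ hy)).trans (le_max_right _ _)⟩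
  obtain ⟨C, hC, hT⟩ := exists_abs_kernel_taylor_le n
  have hγ := rieszGamma_one_pos hn
  refine integrable_of_decay (R := 2 * R) (C := (rieszGamma (n + 1) 1)⁻¹ *
    ((∫ y, |D y|) * (C * R ^ 2))) (continuous_fderiv_apply (contDiff_rieszPotential hφ hc) e)
    (by linarith) (by have : 0 ≤ ∫ y, |D y| := integral_nonneg fun _ => abs_nonneg _; positivity)
    fun x hx => ?_
  have hx0 : x ≠ 0 := by rintro rfl; rw [norm_zero] at hx; linarith
  rw [fderiv_rieszPotential hφ hc, abs_mul, abs_of_pos (inv_pos.2 hγ), mul_assoc]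
  refine mul_le_mul_of_nonneg_left ?_ (inv_pos.2 hγ).le
  have i1 : Integrable (fun y => D y * (‖x - y‖ ^ n)⁻¹) := by
    simpa only [norm_sub_rev] using (integral_abs_mul_inv_norm_sub_pow_le hDi hB x).1
  have heq : ∫ y, D y * (‖x - y‖ ^ n)⁻¹ = ∫ y, D y *
      ((‖x - y‖ ^ n)⁻¹ - (‖x‖ ^ n)⁻¹ - n * ‖x‖⁻¹ ^ (n + 2) * inner ℝ x y) := by
    have : ∀ y, D y * ((‖x - y‖ ^ n)⁻¹ - (‖x‖ ^ n)⁻¹ - n * ‖x‖⁻¹ ^ (n + 2) * inner ℝ x y) =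
        D y * (‖x - y‖ ^ n)⁻¹ - (‖x‖ ^ n)⁻¹ * D y -
          n * ‖x‖⁻¹ ^ (n + 2) * (inner ℝ x y * D y) := fun y => by ring
    simp_rw [this]
    have i2 : Integrable (fun y => D y * (‖x - y‖ ^ n)⁻¹ - (‖x‖ ^ n)⁻¹ * D y) :=
      i1.sub (hDi.const_mul _)
    rw [integral_sub i2 ((hD1i x).const_mul _),
      integral_sub i1 (hDi.const_mul _), integral_const_mul, integral_const_mul, hD0, hD1]
    ring
  change |∫ y, D y * (‖x - y‖ ^ n)⁻¹| ≤ _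
  rw [heq, ← Real.norm_eq_abs]
  refine (norm_integral_le_of_norm_le (hDi.abs.mul_const (C * R ^ 2 * ‖x‖⁻¹ ^ (n + 2)))
    (Eventually.of_forall fun y => ?_)).trans_eq ?_
  · rw [norm_mul, Real.norm_eq_abs, Real.norm_eq_abs]
    by_cases hy : D y = 0
    · simp [hy]
    · have hyR := hsupp y hy
      refine mul_le_mul_of_nonneg_left ((hT x y hx0 (by linarith)).trans ?_) (abs_nonneg _)
      gcongr
  · rw [integral_mul_const]
    ring

lemma integrable_of_apply {F : Rd (n + 1) → Rd (n + 1)} (h : ∀ j, Integrable fun x => F x j) :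
    Integrable F := by
  have : F = fun x => ∑ j, F x j • EuclideanSpace.single j (1 : ℝ) := by
    ext x i
    simp [Finset.sum_apply, Pi.single_apply]
  rw [this]
  exact integrable_finsetSum _ fun j _ => (h j).smul_const _

lemma integrable_rieszTransform (hn : 1 ≤ n) {φ : Rd (n + 1) → ℝ}
    (hφ : ContDiff ℝ (⊤ : ℕ∞) φ) (hc : HasCompactSupport φ) (h0 : ∫ x, φ x = 0) :
    Integrable (rieszTransform (n + 1) φ) :=
  integrable_of_apply (integrable_rieszTransform_apply hn hφ hc h0)

lemma integrable_mul_of_compactSupport {k φ : Rd (n + 1) → ℝ} (hk : LocallyIntegrable k)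
    (hφ : Continuous φ) (hc : HasCompactSupport φ) : Integrable (fun y => k y * φ y) := by
  have := hk.integrable_smul_left_of_hasCompactSupport hφ hc
  simpa only [smul_eq_mul, mul_comm] using this

lemma integrable_log_mul_of_compactSupport (hn : 1 ≤ n) {φ : Rd (n + 1) → ℝ} (hφ : Continuous φ)
    (hc : HasCompactSupport φ) (x : Rd (n + 1)) :
    Integrable (fun y => Real.log (1 / ‖x - y‖) * φ y) := by
  have h := integrable_mul_of_compactSupport (locallyIntegrable_log_norm hn)
    (hφ.comp (by fun_prop : Continuous fun y : Rd (n + 1) => y + x))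
    (hc.comp_homeomorph (Homeomorph.addRight x))
  have h2 := (h.comp_sub_right x).neg
  refine h2.congr (Eventually.of_forall fun y => ?_)
  simp [norm_sub_rev x y]

lemma volume_real_ball_pos (c : Rd (n + 1)) {r : ℝ} (hr : 0 < r) : 0 < volume.real (ball c r) :=
  ENNReal.toReal_pos (measure_ball_pos volume c hr).ne' measure_ball_lt_top.ne

lemma memBMO_of_forall_exists {h : Rd (n + 1) → ℝ} (hloc : LocallyIntegrable h) {C : ℝ}
    (hC : ∀ (c : Rd (n + 1)) (r : ℝ), 0 < r →
      ∃ a : ℝ, ∫ x in ball c r, |h x - a| ≤ C * volume.real (ball c r)) : MemBMO (n + 1) h := by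
  refine ⟨hloc, 2 * C, fun c r hr => ?_⟩
  obtain ⟨a, ha⟩ := hC c r hr
  have hV := volume_real_ball_pos c hr
  have hi := integrableOn_ball hloc c r
  have hconst : ∀ b : ℝ, IntegrableOn (fun _ => b) (ball c r) := fun b =>
    integrableOn_const measure_ball_lt_top.ne
  set A := ⨍ y in ball c r, h y with hA
  have hi1 : ∀ b, IntegrableOn (fun x => |h x - b|) (ball c r) := fun b =>
    (Integrable.sub hi (hconst b)).abs
  have hAa : |A - a| ≤ C := by
    have : A - a = (volume.real (ball c r))⁻¹ * ∫ x in ball c r, (h x - a) := by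
      rw [hA, setAverage_eq, integral_sub hi (hconst a), setIntegral_const, smul_eq_mul, smul_eq_mul]
      field_simp
    rw [this, abs_mul, abs_of_pos (inv_pos.2 hV)]
    calc _ ≤ (volume.real (ball c r))⁻¹ * (C * volume.real (ball c r)) := by
          gcongr
          exact abs_integral_le_integral_abs.trans ha
      _ = C := by field_simp
  have h2 : ∫ x in ball c r, |h x - A| ≤ 2 * C * volume.real (ball c r) := by
    calc ∫ x in ball c r, |h x - A| ≤ ∫ x in ball c r, (|h x - a| + |A - a|) := by
          refine integral_mono (hi1 A) (Integrable.add (hi1 a) (hconst _)) fun x => ?_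
          have := abs_sub_le (h x) a A
          rwa [abs_sub_comm a A] at this
      _ = (∫ x in ball c r, |h x - a|) + volume.real (ball c r) * |A - a| := by
          rw [integral_add (hi1 a) (hconst _), setIntegral_const, smul_eq_mul]
      _ ≤ C * volume.real (ball c r) + volume.real (ball c r) * C := by gcongr
      _ = _ := by ring
  rw [setAverage_eq, smul_eq_mul]
  calc _ ≤ (volume.real (ball c r))⁻¹ * (2 * C * volume.real (ball c r)) := by gcongr
    _ = 2 * C := by field_simp

lemma setIntegral_abs_log_scale {R : ℝ} (hR : 0 < R) :
    ∫ x in ball (0 : Rd (n + 1)) R, |Real.log ‖x‖ - Real.log R| =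
      R ^ (n + 1) * ∫ x in ball (0 : Rd (n + 1)) 1, |Real.log ‖x‖| := by
  have h := Measure.setIntegral_comp_smul_of_pos (volume : Measure (Rd (n + 1)))
    (fun x => |Real.log ‖x‖ - Real.log R|) (ball 0 1) hR
  rw [smul_unitBall_of_pos hR, finrank_euclideanSpace, Fintype.card_fin, smul_eq_mul] at h
  have h2 : ∫ x in ball (0 : Rd (n + 1)) 1, |Real.log ‖R • x‖ - Real.log R| =
      ∫ x in ball (0 : Rd (n + 1)) 1, |Real.log ‖x‖| := by
    refine integral_congr_ae (ae_restrict_of_ae ?_)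
    filter_upwards [ae_ne_point 0] with x hx
    rw [norm_smul, Real.norm_of_nonneg hR.le, Real.log_mul hR.ne' (norm_ne_zero_iff.2 hx),
      add_sub_cancel_left]
  rw [← h2, h]
  field_simp

/-- The mean oscillation of `log |x|` over balls is bounded. -/
lemma exists_log_oscillation_le (hn : 1 ≤ n) : ∃ C : ℝ, 0 ≤ C ∧ ∀ (c : Rd (n + 1)) (r : ℝ), 0 < r →
    ∃ a : ℝ, ∫ x in ball c r, |Real.log ‖x‖ - a| ≤ C * volume.real (ball c r) := by
  have hlog := locallyIntegrable_log_norm hn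
  set I := ∫ x in ball (0 : Rd (n + 1)) 1, |Real.log ‖x‖|
  have hI : 0 ≤ I := integral_nonneg fun _ => abs_nonneg _
  have hV1 := volume_real_ball_pos (0 : Rd (n + 1)) one_pos
  set V1 := volume.real (ball (0 : Rd (n + 1)) 1)
  refine ⟨max (Real.log 2) (3 ^ (n + 1) * I / V1), le_max_of_le_right (by positivity),
    fun c r hr => ?_⟩
  have hV := volume_real_ball_pos c hr
  have hconst : ∀ (c : Rd (n + 1)) (r b : ℝ), IntegrableOn (fun _ => b) (ball c r) := fun c r b =>
    integrableOn_const measure_ball_lt_top.ne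
  have hi1 : ∀ (c : Rd (n + 1)) (r b : ℝ), IntegrableOn (fun x => |Real.log ‖x‖ - b|) (ball c r) :=
    fun c r b => (Integrable.sub (integrableOn_ball hlog c r) (hconst c r b)).abs
  rcases le_or_gt (2 * r) ‖c‖ with hc | hc
  · refine ⟨Real.log ‖c‖, ?_⟩
    have hc0 : 0 < ‖c‖ := by linarith
    calc ∫ x in ball c r, |Real.log ‖x‖ - Real.log ‖c‖|
        ≤ ∫ x in ball c r, Real.log 2 := by
          refine setIntegral_mono_on (hi1 c r _) (hconst c r _) measurableSet_ball fun x hx => ?_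
          rw [mem_ball, dist_eq_norm] at hx
          have h1 := (abs_norm_sub_norm_le x c).trans hx.le
          obtain ⟨h2, h3⟩ := abs_le.1 h1
          have hx0 : 0 < ‖x‖ := by linarith
          have h4 := Real.log_le_log hx0 (show ‖x‖ ≤ 2 * ‖c‖ by linarith)
          have h5 := Real.log_le_log hc0 (show ‖c‖ ≤ 2 * ‖x‖ by linarith)
          rw [Real.log_mul (by norm_num) (by positivity)] at h4 h5
          rw [abs_le]
          constructor <;> linarith
      _ = Real.log 2 * volume.real (ball c r) := by
          rw [setIntegral_const, smul_eq_mul, mul_comm]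
      _ ≤ _ := by gcongr; exact le_max_left _ _
  · refine ⟨Real.log (3 * r), ?_⟩
    have hsub : ball c r ⊆ ball (0 : Rd (n + 1)) (3 * r) := ball_subset_ball' (by
      rw [dist_zero_right]; linarith)
    have hVr : volume.real (ball c r) = r ^ (n + 1) * V1 := by
      rw [Measure.real, Measure.addHaar_ball_of_pos volume c hr, ENNReal.toReal_mul,
        ENNReal.toReal_ofReal (by positivity), finrank_euclideanSpace, Fintype.card_fin]
      rfl
    calc ∫ x in ball c r, |Real.log ‖x‖ - Real.log (3 * r)|
        ≤ ∫ x in ball (0 : Rd (n + 1)) (3 * r), |Real.log ‖x‖ - Real.log (3 * r)| :=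
          setIntegral_mono_set (hi1 _ _ _) (Eventually.of_forall fun _ => abs_nonneg _)
            hsub.eventuallyLE
      _ = 3 ^ (n + 1) * I / V1 * volume.real (ball c r) := by
          rw [setIntegral_abs_log_scale (by positivity), hVr, mul_pow]
          field_simp
          rfl
      _ ≤ _ := by gcongr; exact le_max_right _ _

/-- A bounded perturbation of a multiple of the logarithm is in `BMO`. -/
lemma memBMO_of_abs_sub_log_le (hn : 1 ≤ n) {h : Rd (n + 1) → ℝ} (hm : Measurable h) {M b : ℝ}
    (hM : ∀ x, x ≠ 0 → |h x - b * Real.log ‖x‖| ≤ M) : MemBMO (n + 1) h := by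
  have hlog := locallyIntegrable_log_norm hn
  have hM0 : 0 ≤ M := (abs_nonneg _).trans (hM (EuclideanSpace.single 0 1) (by simp))
  have hlog' : LocallyIntegrable (fun x : Rd (n + 1) => |Real.log ‖x‖|) :=
    hlog.mono measurable_log_norm.abs.aestronglyMeasurable (by simp)
  have hloc : LocallyIntegrable h := by
    refine ((locallyIntegrable_const M).add (hlog'.smul |b|)).mono hm.aestronglyMeasurable ?_
    filter_upwards [ae_ne_point 0] with x hx
    simp only [Pi.add_apply, Pi.smul_apply, smul_eq_mul]
    rw [Real.norm_eq_abs, Real.norm_of_nonneg (by positivity), ← abs_mul]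
    have := abs_sub_abs_le_abs_sub (h x) (b * Real.log ‖x‖)
    linarith [hM x hx]
  obtain ⟨C, -, hC⟩ := exists_log_oscillation_le hn
  refine memBMO_of_forall_exists (C := M + |b| * C) hloc fun c r hr => ?_
  obtain ⟨a, ha⟩ := hC c r hr
  refine ⟨b * a, ?_⟩
  have hconst : ∀ b : ℝ, IntegrableOn (fun _ => b) (ball c r) := fun b =>
    integrableOn_const measure_ball_lt_top.ne
  have hi1 : IntegrableOn (fun x => |Real.log ‖x‖ - a|) (ball c r) :=
    (Integrable.sub (integrableOn_ball hlog c r) (hconst a)).abs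
  have hi2 : IntegrableOn (fun x => |h x - b * a|) (ball c r) :=
    (Integrable.sub (integrableOn_ball hloc c r) (hconst (b * a))).abs
  calc ∫ x in ball c r, |h x - b * a| ≤ ∫ x in ball c r, (M + |b| * |Real.log ‖x‖ - a|) := by
        refine integral_mono_ae hi2 (Integrable.add (hconst M) (Integrable.const_mul hi1 _))
          (ae_restrict_of_ae ?_)
        filter_upwards [ae_ne_point 0] with x hx
        rw [← abs_mul]
        have e : h x - b * a = (h x - b * Real.log ‖x‖) + b * (Real.log ‖x‖ - a) := by ring
        rw [e]
        exact (abs_add_le _ _).trans (by linarith [hM x hx])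
    _ = M * volume.real (ball c r) + |b| * ∫ x in ball c r, |Real.log ‖x‖ - a| := by
        rw [integral_add (hconst M) (Integrable.const_mul hi1 _), setIntegral_const,
          integral_const_mul, smul_eq_mul, mul_comm]
    _ ≤ M * volume.real (ball c r) + |b| * (C * volume.real (ball c r)) := by gcongr
    _ = _ := by ring

lemma memBMO_log_norm (hn : 1 ≤ n) : MemBMO (n + 1) (fun x => Real.log ‖x‖) :=
  memBMO_of_abs_sub_log_le hn measurable_log_norm (M := 0) (b := 1) fun x _ => by simp

/-- A representative of the Riesz transform `R_j g_j ∈ BMO` of `g_j = logDensity d j`. -/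
noncomputable def logComponent (n : ℕ) (j : Fin (n + 1)) (x : Rd (n + 1)) : ℝ :=
  (rieszGamma (n + 1) 1 * (n * rieszGamma (n + 1) n))⁻¹ *
    (logKernel (unitFieldDeriv n j) x - n * kernelConst n / (n + 1))

lemma measurable_logComponent (j : Fin (n + 1)) : Measurable (logComponent n j) :=
  ((measurable_logKernel (isHomKernel_unitFieldDeriv j)).sub_const _).const_mul _

lemma log_norm_eq_sum_logComponent (hn : 1 ≤ n) {x : Rd (n + 1)} (hx : x ≠ 0) :
    Real.log ‖x‖ = -logGamma (n + 1) * ∑ j, logComponent n j x := by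
  have hn0 : (0 : ℝ) < n := by exact_mod_cast hn
  have hκ := logGamma_pos (n := n)
  have hσ := sphereArea_pos (n := n)
  have hγ1 := rieszGamma_one_pos hn
  have hγn := rieszGamma_last_pos hn
  have hγκ := rieszGamma_one_mul_last hn
  simp only [logComponent]
  rw [← Finset.mul_sum, Finset.sum_sub_distrib, sum_logKernel_unitFieldDeriv hn hx]
  have e : rieszGamma (n + 1) 1 * (n * rieszGamma (n + 1) n) =
      n * (logGamma (n + 1) * sphereArea n) := by rw [← hγκ]; ring
  rw [e]
  simp only [Finset.sum_const, Finset.card_univ, Fintype.card_fin, nsmul_eq_mul]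
  push_cast
  field_simp
  ring

lemma memBMO_logComponent (hn : 1 ≤ n) (j : Fin (n + 1)) : MemBMO (n + 1) (logComponent n j) := by
  set q := (rieszGamma (n + 1) 1 * (n * rieszGamma (n + 1) n))⁻¹ with hq
  refine memBMO_of_abs_sub_log_le hn (measurable_logComponent j)
    (M := |q| * (absKernelConst n + |n * kernelConst n / (n + 1)|))
    (b := -(q * (n / (n + 1) * sphereArea n))) fun x hx => ?_
  have e : logComponent n j x - -(q * (n / (n + 1) * sphereArea n)) * Real.log ‖x‖ =
      q * ((logKernel (unitFieldDeriv n j) x + n / (n + 1) * sphereArea n * Real.log ‖x‖) -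
        n * kernelConst n / (n + 1)) := by
    rw [logComponent, ← hq]; ring
  rw [e, abs_mul]
  have h1 := abs_logKernel_unitFieldDeriv_add_log_le hn j hx
  gcongr
  exact (abs_sub _ _).trans (by linarith)

lemma logDensity_eq (j : Fin (n + 1)) (x : Rd (n + 1)) :
    logDensity (n + 1) j x = (n * rieszGamma (n + 1) n)⁻¹ * unitField (n + 1) x j := by
  have e1 : (((n + 1 : ℕ) : ℝ) - 1) = n := by push_cast; ring
  rw [logDensity, e1, one_div]

lemma isRieszTransformBMO_logComponent (hn : 1 ≤ n) (j : Fin (n + 1)) :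
    IsRieszTransformBMO (n + 1) j (logDensity (n + 1) j) (logComponent n j) := by
  refine ⟨memBMO_logComponent hn j, fun φ hφ hc h0 => ?_⟩
  have hγ1 := rieszGamma_one_pos hn
  have hγn := rieszGamma_last_pos hn
  have hn0 : (0 : ℝ) < n := by exact_mod_cast hn
  have hφi := integrable_of_continuous_compactSupport hφ.continuous hc
  have hlog := integrable_log_mul_of_compactSupport hn hφ.continuous hc 0
  obtain ⟨-, h1, h2⟩ := riesz_fubini hn (isHomKernel_unitFieldDeriv j) hφi h0 hlog
  obtain ⟨h3, -, -⟩ := riesz_fubini hn isHomKernel_inv_norm hφi h0 hlog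
  have h4 := integral_rieszPotential_mul_unitFieldDeriv (hasRieszTransform_rieszTransform hφ hc
    (integrable_rieszTransform hn hφ hc h0)) h3 j
  rw [h2] at h4
  simp only [sub_zero] at h1 h4
  simp_rw [logDensity_eq, mul_assoc]
  rw [integral_const_mul]
  have e : ∀ x, logComponent n j x * φ x = (rieszGamma (n + 1) 1 * (n * rieszGamma (n + 1) n))⁻¹ *
      (φ x * logKernel (unitFieldDeriv n j) x - n * kernelConst n / (n + 1) * φ x) := fun x => by
    rw [logComponent]; ring
  simp_rw [e]
  rw [integral_const_mul, integral_sub h1 (hφi.const_mul _), integral_const_mul, h0, mul_zero,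
    sub_zero, mul_inv]
  rw [mul_comm (rieszGamma (n + 1) 1)⁻¹, mul_assoc, h4]
  ring

lemma setIntegral_ball_comp_sub (g : Rd (n + 1) → ℝ) (c y : Rd (n + 1)) (r : ℝ) :
    ∫ x in ball c r, g (x - y) = ∫ x in ball (c - y) r, g x := by
  have h := (measurePreserving_sub_right (volume : Measure (Rd (n + 1))) y).setIntegral_preimage_emb
    (MeasurableEquiv.subRight y).measurableEmbedding g (ball (c - y) r)
  rw [← h]
  congr 2
  ext x
  simp [dist_eq_norm]

lemma integrableOn_ball_comp_sub {g : Rd (n + 1) → ℝ} (hg : LocallyIntegrable g)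
    (c y : Rd (n + 1)) (r : ℝ) : IntegrableOn (fun x => g (x - y)) (ball c r) := by
  have h := ((measurePreserving_sub_right (volume : Measure (Rd (n + 1))) y).integrableOn_comp_preimage
    (MeasurableEquiv.subRight y).measurableEmbedding).2 (integrableOn_ball hg (c - y) r)
  refine h.mono_set fun x hx => ?_
  simpa [dist_eq_norm] using hx

section Convolution

variable {h f : Rd (n + 1) → ℝ} {Ω : Set (Rd (n + 1))}

lemma integrable_prod_conv (hh : LocallyIntegrable h) (hm : Measurable h) (hΩ : MeasurableSet Ω)
    (hb : Bornology.IsBounded Ω) (hf : IntegrableOn f Ω) (c : Rd (n + 1)) (r : ℝ) :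
    Integrable (fun p : Rd (n + 1) × Rd (n + 1) => h (p.1 - p.2) * f p.2)
      ((volume.restrict (ball c r)).prod (volume.restrict Ω)) := by
  obtain ⟨R, hR⟩ := hb.exists_norm_le
  have hmeas : AEStronglyMeasurable (fun p : Rd (n + 1) × Rd (n + 1) => h (p.1 - p.2) * f p.2)
      ((volume.restrict (ball c r)).prod (volume.restrict Ω)) :=
    (hm.comp (by fun_prop)).aestronglyMeasurable.mul hf.aestronglyMeasurable.comp_snd
  have hslice := fun y => integrableOn_ball_comp_sub hh c y r
  refine (integrable_prod_iff' hmeas).2 ⟨Eventually.of_forall fun y => (hslice y).mul_const (f y), ?_⟩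
  refine (hf.norm.const_mul (∫ x in ball (0 : Rd (n + 1)) (‖c‖ + R + r), |h x|)).mono'
    hmeas.norm.prod_swap.integral_prod_right' ?_
  filter_upwards [ae_restrict_mem hΩ] with y hy
  rw [Real.norm_of_nonneg (integral_nonneg fun _ => norm_nonneg _)]
  simp_rw [norm_mul, Real.norm_eq_abs]
  rw [integral_mul_const, setIntegral_ball_comp_sub (fun x => |h x|)]
  refine mul_le_mul_of_nonneg_right ?_ (abs_nonneg _)
  refine setIntegral_mono_set (integrableOn_ball hh _ _).abs
    (Eventually.of_forall fun _ => abs_nonneg _) (ball_subset_ball' ?_).eventuallyLE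
  rw [dist_zero_right]
  have := norm_sub_le c y
  have := hR y hy
  linarith

lemma ae_integrable_conv (hh : LocallyIntegrable h) (hm : Measurable h) (hΩ : MeasurableSet Ω)
    (hb : Bornology.IsBounded Ω) (hf : IntegrableOn f Ω) :
    ∀ᵐ x : Rd (n + 1), IntegrableOn (fun y => h (x - y) * f y) Ω := by
  have h1 : ∀ k : ℕ, ∀ᵐ x : Rd (n + 1), x ∈ ball (0 : Rd (n + 1)) k →
      IntegrableOn (fun y => h (x - y) * f y) Ω := fun k =>
    (ae_restrict_iff' measurableSet_ball).1 (integrable_prod_conv hh hm hΩ hb hf 0 k).prod_right_ae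
  filter_upwards [ae_all_iff.2 h1] with x hx
  obtain ⟨k, hk⟩ := exists_nat_gt ‖x‖
  exact hx k (by simpa using hk)

lemma locallyIntegrable_conv (hh : LocallyIntegrable h) (hm : Measurable h) (hΩ : MeasurableSet Ω)
    (hb : Bornology.IsBounded Ω) (hf : IntegrableOn f Ω) :
    LocallyIntegrable (fun x => ∫ y in Ω, h (x - y) * f y) := by
  refine locallyIntegrable_iff.2 fun k hk => ?_
  obtain ⟨R, -, hR⟩ := hk.isBounded.exists_pos_norm_lt
  have : IntegrableOn (fun x => ∫ y in Ω, h (x - y) * f y) (ball 0 R) :=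
    (integrable_prod_conv hh hm hΩ hb hf 0 R).integral_prod_left
  exact this.mono_set fun x hx => by simpa using hR x hx

/-- The convolution of a `BMO` function with an integrable function of bounded support is
in `BMO`. -/
lemma memBMO_conv (hh : MemBMO (n + 1) h) (hm : Measurable h) (hΩ : MeasurableSet Ω)
    (hb : Bornology.IsBounded Ω) (hf : IntegrableOn f Ω) :
    MemBMO (n + 1) (fun x => ∫ y in Ω, h (x - y) * f y) := by
  obtain ⟨hloc, C, hC⟩ := hh
  refine memBMO_of_forall_exists (C := C * ∫ y in Ω, |f y|)
    (locallyIntegrable_conv hloc hm hΩ hb hf) fun c r hr => ?_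
  have hV := volume_real_ball_pos c hr
  have : IsFiniteMeasure (volume.restrict (ball c r)) := ⟨by simpa using measure_ball_lt_top⟩
  have hprod := integrable_prod_conv hloc hm hΩ hb hf c r
  let a : Rd (n + 1) → ℝ := fun y => ⨍ x in ball (c - y) r, h x
  have ha : ∀ y, a y * f y = (volume.real (ball c r))⁻¹ * ∫ x in ball c r, h (x - y) * f y :=
    fun y => by
      simp only [a]
      rw [setAverage_eq, integral_mul_const, setIntegral_ball_comp_sub h, smul_eq_mul,
        Measure.addHaar_real_ball_center volume c, Measure.addHaar_real_ball_center volume (c - y)]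
      ring
  have hai : IntegrableOn (fun y => a y * f y) Ω := by
    simp_rw [ha]
    exact Integrable.const_mul hprod.integral_prod_right _
  refine ⟨∫ y in Ω, a y * f y, ?_⟩
  have hdiff : Integrable (fun p : Rd (n + 1) × Rd (n + 1) => (h (p.1 - p.2) - a p.2) * f p.2)
      ((volume.restrict (ball c r)).prod (volume.restrict Ω)) := by
    have := hprod.sub (Integrable.comp_snd hai (volume.restrict (ball c r)))
    refine this.congr (Eventually.of_forall fun p => ?_)
    simp only [Pi.sub_apply]
    ring
  have hosc : ∀ y, ∫ x in ball c r, |(h (x - y) - a y) * f y| ≤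
      C * |f y| * volume.real (ball c r) := fun y => by
    have h1 := hC (c - y) r hr
    rw [setAverage_eq, smul_eq_mul, Measure.addHaar_real_ball_center volume (c - y),
      ← Measure.addHaar_real_ball_center volume c, inv_mul_le_iff₀ hV] at h1
    simp_rw [abs_mul]
    rw [integral_mul_const, setIntegral_ball_comp_sub (fun x => |h x - a y|)]
    calc _ ≤ volume.real (ball c r) * C * |f y| := by gcongr
      _ = _ := by ring
  calc ∫ x in ball c r, |(∫ y in Ω, h (x - y) * f y) - ∫ y in Ω, a y * f y|
      ≤ ∫ x in ball c r, ∫ y in Ω, |(h (x - y) - a y) * f y| := by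
        refine integral_mono_ae ?_ hdiff.abs.integral_prod_left ?_
        · exact (Integrable.sub hprod.integral_prod_left
            (integrableOn_const measure_ball_lt_top.ne)).abs
        · filter_upwards [hprod.prod_right_ae] with x hx
          rw [← integral_sub hx hai]
          simp_rw [← sub_mul]
          exact abs_integral_le_integral_abs
    _ = ∫ y in Ω, ∫ x in ball c r, |(h (x - y) - a y) * f y| :=
        integral_integral_swap (f := fun x y => |(h (x - y) - a y) * f y|) hdiff.abs
    _ ≤ ∫ y in Ω, C * |f y| * volume.real (ball c r) :=
        integral_mono hdiff.abs.integral_prod_right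
          (((Integrable.abs hf).const_mul C).mul_const _) hosc
    _ = _ := by rw [integral_mul_const, integral_const_mul]

lemma rieszTransform_comp_add (φ : Rd (n + 1) → ℝ) (y x : Rd (n + 1)) (j : Fin (n + 1)) :
    rieszTransform (n + 1) (fun x => φ (x + y)) x j = rieszTransform (n + 1) φ (x + y) j := by
  have : rieszPotential (n + 1) 1 (fun x => φ (x + y)) =
      fun x => rieszPotential (n + 1) 1 φ (x + y) := by
    ext x
    rw [rieszPotential_one, rieszPotential_one,
      ← integral_add_right_eq_self (fun z => φ z * (‖x + y - z‖ ^ n)⁻¹) y]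
    simp only [add_sub_add_right_eq_sub]
  rw [rieszTransform_apply, rieszTransform_apply, this, fderiv_comp_add_right]

/-- The relation `h = R_j g` in `BMO` is preserved by convolution with an integrable function of
bounded support. -/
lemma isRieszTransformBMO_conv (hn : 1 ≤ n) {g : Rd (n + 1) → ℝ} {j : Fin (n + 1)}
    (hh : IsRieszTransformBMO (n + 1) j g h) (hm : Measurable h) (hg : Measurable g) {B : ℝ}
    (hB : ∀ x, |g x| ≤ B) (hΩ : MeasurableSet Ω) (hb : Bornology.IsBounded Ω)
    (hf : IntegrableOn f Ω) :
    IsRieszTransformBMO (n + 1) j (fun x => ∫ y in Ω, g (x - y) * f y)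
      (fun x => ∫ y in Ω, h (x - y) * f y) := by
  refine ⟨memBMO_conv hh.1 hm hΩ hb hf, fun φ hφ hc h0 => ?_⟩
  set ρ : Rd (n + 1) → ℝ := fun x => rieszTransform (n + 1) φ x j
  have hρ : Integrable ρ := integrable_rieszTransform_apply hn hφ hc h0 j
  obtain ⟨P, hP⟩ := exists_abs_le hφ.continuous hc
  obtain ⟨R, -, hR⟩ := hc.isBounded.exists_pos_norm_lt
  have hout : ∀ x, x ∉ ball (0 : Rd (n + 1)) R → φ x = 0 := fun x hx =>
    image_eq_zero_of_notMem_tsupport fun hx' => hx (by simpa using hR x hx')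
  have hball : ∀ k : Rd (n + 1) → ℝ, ∫ x, k x * φ x = ∫ x in ball (0 : Rd (n + 1)) R, k x * φ x :=
    fun k => (setIntegral_eq_integral_of_forall_compl_eq_zero fun x hx => by
      rw [hout x hx, mul_zero]).symm
  have hpair : ∀ y, ∫ x, h (x - y) * φ x = -∫ x, g (x - y) * ρ x := fun y => by
    have h1 := hh.2 (fun x => φ (x + y)) (hφ.comp (by fun_prop))
      (hc.comp_homeomorph (Homeomorph.addRight y))
      (by rw [integral_add_right_eq_self (fun x => φ x), h0])
    simp only [rieszTransform_comp_add] at h1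
    rw [← integral_sub_right_eq_self (fun x => h x * φ (x + y)) y,
      ← integral_sub_right_eq_self (fun x => g x * rieszTransform (n + 1) φ (x + y) j) y] at h1
    simpa only [sub_add_cancel] using h1
  have hprod : Integrable (fun p : Rd (n + 1) × Rd (n + 1) => φ p.1 * (h (p.1 - p.2) * f p.2))
      ((volume.restrict (ball (0 : Rd (n + 1)) R)).prod (volume.restrict Ω)) :=
    (integrable_prod_conv hh.1.1 hm hΩ hb hf 0 R).bdd_mul
      (hφ.continuous.comp continuous_fst).aestronglyMeasurable
      (Eventually.of_forall fun p => hP p.1)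
  have hprod2 : Integrable (fun p : Rd (n + 1) × Rd (n + 1) => g (p.1 - p.2) * (ρ p.1 * f p.2))
      (volume.prod (volume.restrict Ω)) :=
    (Integrable.mul_prod hρ hf).bdd_mul (hg.comp (by fun_prop)).aestronglyMeasurable
      (Eventually.of_forall fun p => hB _)
  calc ∫ x, (∫ y in Ω, h (x - y) * f y) * φ x
      = ∫ x in ball (0 : Rd (n + 1)) R, ∫ y in Ω, φ x * (h (x - y) * f y) := by
        rw [hball]
        simp_rw [integral_const_mul, mul_comm]
    _ = ∫ y in Ω, ∫ x in ball (0 : Rd (n + 1)) R, φ x * (h (x - y) * f y) :=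
        integral_integral_swap (f := fun x y => φ x * (h (x - y) * f y)) hprod
    _ = ∫ y in Ω, -∫ x, g (x - y) * (ρ x * f y) := by
        congr 1
        ext y
        have e1 : ∀ x, φ x * (h (x - y) * f y) = h (x - y) * φ x * f y := fun x => by ring
        have e2 : ∀ x, g (x - y) * (ρ x * f y) = g (x - y) * ρ x * f y := fun x => by ring
        simp_rw [e1, e2]
        rw [integral_mul_const, integral_mul_const, ← hball (fun x => h (x - y)), hpair]
        ring
    _ = -∫ x, ∫ y in Ω, g (x - y) * (ρ x * f y) := by
        rw [integral_neg, integral_integral_swap (f := fun x y => g (x - y) * (ρ x * f y)) hprod2]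
    _ = -∫ x, (∫ y in Ω, g (x - y) * f y) * ρ x := by
        congr 2
        ext x
        rw [← integral_mul_const]
        congr 1
        ext y
        ring

end Convolution

lemma abs_logDensity_le (j : Fin (n + 1)) (x : Rd (n + 1)) : |logDensity (n + 1) j x| ≤
    |1 / ((((n + 1 : ℕ) : ℝ) - 1) * rieszGamma (n + 1) (((n + 1 : ℕ) : ℝ) - 1))| := by
  rw [logDensity, abs_mul]
  exact mul_le_of_le_one_right (abs_nonneg _) (abs_unitField_apply_le x j)

lemma measurable_logDensity (j : Fin (n + 1)) : Measurable (logDensity (n + 1) j) :=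
  (measurable_unitField_apply j).const_mul _

lemma memLp_logDensity (j : Fin (n + 1)) : MemLp (logDensity (n + 1) j) ⊤ :=
  memLp_top_of_bound (measurable_logDensity j).aestronglyMeasurable _
    (Eventually.of_forall (abs_logDensity_le j))

lemma logPotentialDensity_eq (Ω : Set (Rd (n + 1))) (f : Rd (n + 1) → ℝ) (j : Fin (n + 1)) :
    logPotentialDensity (n + 1) Ω f j = fun x => ∫ y in Ω, logDensity (n + 1) j (x - y) * f y := by
  ext x
  simp_rw [logPotentialDensity, logDensity, mul_assoc]
  rw [integral_const_mul]

lemma memLp_logPotentialDensity {Ω : Set (Rd (n + 1))} {f : Rd (n + 1) → ℝ}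
    (hf : IntegrableOn f Ω) (j : Fin (n + 1)) : MemLp (logPotentialDensity (n + 1) Ω f j) ⊤ := by
  rw [logPotentialDensity_eq]
  refine memLp_top_of_bound (C := ∫ y in Ω,
    |1 / ((((n + 1 : ℕ) : ℝ) - 1) * rieszGamma (n + 1) (((n + 1 : ℕ) : ℝ) - 1))| * ‖f y‖) ?_
    (Eventually.of_forall fun x => ?_)
  · have : AEStronglyMeasurable (fun p : Rd (n + 1) × Rd (n + 1) =>
        logDensity (n + 1) j (p.1 - p.2) * f p.2) (volume.prod (volume.restrict Ω)) :=
      ((measurable_logDensity j).comp (by fun_prop)).aestronglyMeasurable.mul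
        hf.aestronglyMeasurable.comp_snd
    exact this.integral_prod_right'
  · refine norm_integral_le_of_norm_le (Integrable.const_mul (Integrable.norm hf) _)
      (Eventually.of_forall fun y => ?_)
    rw [norm_mul]
    exact mul_le_mul_of_nonneg_right (abs_logDensity_le j _) (norm_nonneg _)

lemma logGamma_two : logGamma 2 = 2 * Real.pi := by
  have e : ((2 : ℕ) : ℝ) - 1 = 1 := by norm_num
  simp only [logGamma, e]
  norm_num [Real.Gamma_one]
  ring

lemma rieszGamma_two_one : (((2 : ℕ) : ℝ) - 1) * rieszGamma 2 (((2 : ℕ) : ℝ) - 1) =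
    2 * Real.pi := by
  have e : ((2 : ℕ) : ℝ) - 1 = 1 := by norm_num
  have h := Real.Gamma_pos_of_pos (show (0 : ℝ) < 1 / 2 by norm_num)
  simp only [rieszGamma, e]
  norm_num
  field_simp

lemma norm_unitField_le (y : Rd (n + 1)) : ‖unitField (n + 1) y‖ ≤ 1 := by
  rw [unitField, norm_smul, norm_inv, norm_norm]
  exact inv_mul_le_one

lemma eLpNorm_logPotential_two_le {f : Rd 2 → ℝ} {F : Rd 2 → Rd 2} (hF : Integrable F)
    (h : ∀ᵐ x : Rd 2, logPotential 2 f x =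
      1 / (2 * Real.pi) * ∫ y, inner ℝ (unitField 2 (x - y)) (F y)) :
    eLpNorm (logPotential 2 f) ⊤ volume ≤
      ENNReal.ofReal (1 / (2 * Real.pi)) * eLpNorm F 1 volume := by
  have hpi := Real.pi_pos
  rw [eLpNorm_exponent_top, eLpNorm_one_eq_lintegral_enorm,
    ← ofReal_integral_norm_eq_lintegral_enorm hF, ← ENNReal.ofReal_mul (by positivity)]
  refine eLpNormEssSup_le_of_ae_bound ?_
  filter_upwards [h] with x hx
  rw [hx, norm_mul, Real.norm_of_nonneg (by positivity)]
  refine mul_le_mul_of_nonneg_left ?_ (by positivity)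
  refine norm_integral_le_of_norm_le hF.norm (Eventually.of_forall fun y => ?_)
  refine (norm_inner_le_norm _ _).trans ?_
  exact mul_le_of_le_one_left (norm_nonneg _) (norm_unitField_le (n := 1) _)

lemma ae_setIntegral_log_eq_sum (hn : 1 ≤ n) {Ω : Set (Rd (n + 1))} {f : Rd (n + 1) → ℝ}
    (hΩ : MeasurableSet Ω) (hb : Bornology.IsBounded Ω) (hf : IntegrableOn f Ω) :
    ∀ᵐ x : Rd (n + 1), (∫ y in Ω, Real.log ‖x - y‖ * f y) =
      -logGamma (n + 1) * ∑ j, ∫ y in Ω, logComponent n j (x - y) * f y := by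
  have hi : ∀ᵐ x : Rd (n + 1), ∀ j,
      IntegrableOn (fun y => logComponent n j (x - y) * f y) Ω := ae_all_iff.2 fun j =>
    ae_integrable_conv (memBMO_logComponent hn j).1 (measurable_logComponent j) hΩ hb hf
  filter_upwards [hi] with x hx
  rw [← integral_finsetSum _ fun j _ => hx j, ← integral_const_mul]
  refine integral_congr_ae (ae_restrict_of_ae ?_)
  filter_upwards [ae_ne_point x] with y hy
  rw [log_norm_eq_sum_logComponent hn (sub_ne_zero.2 hy.symm), ← Finset.sum_mul, mul_assoc]

end RieszLog

open RieszLog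

theorem mainTheorem2 :
    -- the representation formula, for `f ∈ L¹` with finite logarithmic moment and `Rf = F ∈ L¹`
    (∀ d : ℕ, 2 ≤ d → ∀ (f : Rd d → ℝ) (F : Rd d → Rd d),
      MeasureTheory.Integrable f →
      MeasureTheory.Integrable (fun y => Real.log (1 + ‖y‖) * f y) →
      HasRieszTransform d f F →
      (∀ᵐ x : Rd d, MeasureTheory.Integrable (fun y => Real.log (1 / ‖x - y‖) * f y)) ∧
      ∀ x : Rd d, MeasureTheory.Integrable (fun y => Real.log (1 / ‖x - y‖) * f y) →
        MeasureTheory.Integrable (fun y => rieszPotential d 1 f y / ‖x - y‖) ∧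
        logPotential d f x = rieszPotential d ((d : ℝ) - 1) (rieszPotential d 1 f) x ∧
        logPotential d f x = 1 / (((d : ℝ) - 1) * rieszGamma d ((d : ℝ) - 1)) *
          ∫ y, inner ℝ (F y) (unitField d (x - y))) ∧
    -- for test functions with `Rf = ∇ I_1 f ∈ L¹` it holds at every point
    (∀ d : ℕ, 2 ≤ d → ∀ f : Rd d → ℝ, ContDiff ℝ (⊤ : ℕ∞) f → HasCompactSupport f →
      MeasureTheory.Integrable (rieszTransform d f) →
      HasRieszTransform d f (rieszTransform d f) ∧
      ∀ x : Rd d,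
        logPotential d f x = rieszPotential d ((d : ℝ) - 1) (rieszPotential d 1 f) x ∧
        logPotential d f x = 1 / (((d : ℝ) - 1) * rieszGamma d ((d : ℝ) - 1)) *
          ∫ y, inner ℝ (rieszTransform d f y) (unitField d (x - y))) ∧
    -- the plane: `I_2 f = (2π)⁻¹ ∫ log (1/|x-y|) f(y) dy`, and the bound by `‖Rf‖_1`
    (∀ (f : Rd 2 → ℝ) (F : Rd 2 → Rd 2),
      MeasureTheory.Integrable f →
      MeasureTheory.Integrable (fun y => Real.log (1 + ‖y‖) * f y) →
      HasRieszTransform 2 f F →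
      (∀ x : Rd 2, logPotential 2 f x =
        1 / (2 * Real.pi) * ∫ y, Real.log (1 / ‖x - y‖) * f y) ∧
      (∀ x : Rd 2, MeasureTheory.Integrable (fun y => Real.log (1 / ‖x - y‖) * f y) →
        logPotential 2 f x =
          1 / (2 * Real.pi) * ∫ y, inner ℝ (unitField 2 (x - y)) (F y)) ∧
      MeasureTheory.eLpNorm (logPotential 2 f) ⊤ MeasureTheory.volume ≤
        ENNReal.ofReal (1 / (2 * Real.pi)) *
          MeasureTheory.eLpNorm F 1 MeasureTheory.volume) ∧
    -- the decomposition of `log |x|` in `BMO`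
    (∀ d : ℕ, 2 ≤ d →
      MemBMO d (fun x => Real.log ‖x‖) ∧
      (∀ j : Fin d, MeasureTheory.MemLp (logDensity d j) ⊤ MeasureTheory.volume) ∧
      ∃ h : Fin d → Rd d → ℝ,
        (∀ j : Fin d, IsRieszTransformBMO d j (logDensity d j) (h j)) ∧
        ∀ᵐ x : Rd d, Real.log ‖x‖ = -logGamma d * ∑ j, h j x) ∧
    -- the decomposition of the logarithmic potentials of John and Nirenberg
    (∀ d : ℕ, 2 ≤ d → ∀ (Ω : Set (Rd d)) (f : Rd d → ℝ),
      MeasurableSet Ω → Bornology.IsBounded Ω →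
      MeasureTheory.IntegrableOn f Ω MeasureTheory.volume →
      MemBMO d (fun x => ∫ y in Ω, Real.log ‖x - y‖ * f y) ∧
      (∀ j : Fin d,
        MeasureTheory.MemLp (logPotentialDensity d Ω f j) ⊤ MeasureTheory.volume) ∧
      ∃ h : Fin d → Rd d → ℝ,
        (∀ j : Fin d, IsRieszTransformBMO d j (logPotentialDensity d Ω f j) (h j)) ∧
        ∀ᵐ x : Rd d, (∫ y in Ω, Real.log ‖x - y‖ * f y) = -logGamma d * ∑ j, h j x) := by
  have hsucc : ∀ d : ℕ, 2 ≤ d → ∃ n : ℕ, 1 ≤ n ∧ d = n + 1 := fun d hd =>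
    ⟨d - 1, by omega, by omega⟩
  refine ⟨?_, ?_, ?_, ?_, ?_⟩
  · intro d hd f F hf hlog hF
    obtain ⟨n, hn, rfl⟩ := hsucc d hd
    exact ⟨ae_integrable_log_mul hn hf hlog, fun x hx => logPotential_representation hn hf hF hx⟩
  · intro d hd f hf hc hi
    obtain ⟨n, hn, rfl⟩ := hsucc d hd
    have hF := hasRieszTransform_rieszTransform hf hc hi
    exact ⟨hF, fun x => (logPotential_representation hn
      (integrable_of_continuous_compactSupport hf.continuous hc) hF
      (integrable_log_mul_of_compactSupport hn hf.continuous hc x)).2⟩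
  · intro f F hf hlog hF
    have hrep : ∀ x : Rd 2,
        MeasureTheory.Integrable (fun y => Real.log (1 / ‖x - y‖) * f y) →
        logPotential 2 f x =
          1 / (2 * Real.pi) * ∫ y, inner ℝ (unitField 2 (x - y)) (F y) := fun x hx => by
      have h := (logPotential_representation (n := 1) le_rfl hf hF hx).2.2
      rw [h, rieszGamma_two_one]
      simp only [real_inner_comm]
    refine ⟨fun x => by rw [logPotential, logGamma_two], hrep, ?_⟩
    exact eLpNorm_logPotential_two_le hF.1
      ((ae_integrable_log_mul (n := 1) le_rfl hf hlog).mono hrep)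
  · intro d hd
    obtain ⟨n, hn, rfl⟩ := hsucc d hd
    exact ⟨memBMO_log_norm hn, memLp_logDensity, logComponent n,
      isRieszTransformBMO_logComponent hn,
      (ae_ne_point 0).mono fun x hx => log_norm_eq_sum_logComponent hn hx⟩
  · intro d hd Ω f hΩ hb hf
    obtain ⟨n, hn, rfl⟩ := hsucc d hd
    refine ⟨memBMO_conv (memBMO_log_norm hn) measurable_log_norm hΩ hb hf,
      memLp_logPotentialDensity hf, fun j x => ∫ y in Ω, logComponent n j (x - y) * f y,
      fun j => ?_, ae_setIntegral_log_eq_sum hn hΩ hb hf⟩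
    rw [logPotentialDensity_eq]
    exact isRieszTransformBMO_conv hn (isRieszTransformBMO_logComponent hn j)
      (measurable_logComponent j) (measurable_logDensity j) (abs_logDensity_le j) hΩ hb hf
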